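/- Let $\alpha\in(\tfrac12,2]$, $a\in\mathbb R$, $\lambda>0$. On $2$-periodic functions (i.e. on $[-1,1]$ with end points identified) let $\Lambda^s$ be the Fourier multiplier with symbol $(\pi|k|)^s$, and let $H^s$ be the corresponding periodic Sobolev space. Let $\varphi=\varphi_\lambda\in H^{\alpha/2}$ be a real-valued minimizer of $$\mathcal E_a[u]=\frac12\int_{-1}^1|\Lambda^{\alpha/2}u|^2\,dx-\frac13\int_{-1}^1|u|^3\,dx+a\int_{-1}^1|u|\,dx$$ over all real-valued $u\in H^{\alpha/2}$ with $\int_{-1}^1u^2\,dx=\lambda$, and suppose that $\varphi$ is bell-shaped (nonnegative, even, and non-increasing on $[0,1]$). If $a>0$, suppose also that $\varphi>0$ almost everywhere; if $a=-\lambda/2$, suppose also that $\varphi$ is not constant. Let $$\omega=\frac{1}{\lambda}\Big(\int_{-1}^1\varphi^3\,dx-\int_{-1}^1|\Lambda^{\alpha/2}\varphi|^2\,dx-a\int_{-1}^1\varphi\,dx\Big)$$ be the associated Lagrange multiplier and $\mathcal L_+=\Lambda^\alpha+\omega-2\varphi$, with domain $D(\mathcal L_+)=H^\alpha$. Then $\varphi$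 is weakly non-degenerate: $\varphi\perp \mathrm{Ker}[\mathcal L_+]$ in $L^2[-1,1]$, i.e. $\int_{-1}^1 h\,\varphi\,dx=0$ for every (complex-valued) $h\in H^\alpha$ with $\mathcal L_+h=0$. -/

import Mathlib

open MeasureTheory

noncomputable section

namespace FracWave

instance fact_two_pos : Fact ((0 : ℝ) < 2) := ⟨two_pos⟩

/-- The circle `ℝ / 2ℤ`, i.e. the interval `[-1, 1]` with its end points identified. Functions on it
are the `2`-periodic functions; its canonical measure `volume` has total mass `2`, so that integrals
over it are integrals over `[-1, 1]` with respect to `dx`. -/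
abbrev Circ : Type := AddCircle (2 : ℝ)

/-- `f ∈ H^s[-1, 1]`: `f` is square integrable and `∑ (1 + |k|²)^s |f̂(k)|² < ∞`, where
`f̂(k) = (1/2) ∫_{-1}^1 f(x) e^{-iπkx} dx`. -/
def InSobolev (s : ℝ) (f : Circ → ℂ) : Prop :=
  MemLp f 2 volume ∧ Summable fun k : ℤ => (1 + |(k : ℝ)| ^ 2) ^ s * ‖fourierCoeff f k‖ ^ 2

/-- The Fourier coefficients `(π|k|)^s f̂(k)` of `Λ^s f`. -/
def fracCoeff (s : ℝ) (f : Circ → ℂ) (k : ℤ) : ℂ :=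
  (((Real.pi * |(k : ℝ)|) ^ s : ℝ) : ℂ) * fourierCoeff f k

open Classical in
/-- The fractional derivative `Λ^s f`, as an `L²` function: the sum of the Fourier series with
coefficients `(π|k|)^s f̂(k)`. (The value is `0` if these are not square summable, which does not
happen for `f ∈ H^s`, `s ≥ 0`.) -/
def fracLap (s : ℝ) (f : Circ → ℂ) : Lp ℂ 2 (AddCircle.haarAddCircle (T := 2)) :=
  if h : Memℓp (fracCoeff s f) 2 then
    (fourierBasis (T := 2)).repr.symm (⟨fracCoeff s f, h⟩ : lp (fun _ : ℤ => ℂ) 2)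
  else 0

/-- A real-valued function viewed as a complex-valued one. -/
def toC (u : Circ → ℝ) : Circ → ℂ := fun x => (u x : ℂ)

/-- `∫_{-1}^1 |Λ^{α/2} u|² dx`. -/
def kinetic (α : ℝ) (u : Circ → ℝ) : ℝ :=
  ∫ x : Circ, ‖(fracLap (α / 2) (toC u) : Circ → ℂ) x‖ ^ 2

/-- The energy `½ ∫ |Λ^{α/2} u|² - ⅓ ∫ |u|³ + a ∫ |u|`. -/
def energy (α a : ℝ) (u : Circ → ℝ) : ℝ :=
  (1 / 2) * kinetic α u - (1 / 3) * (∫ x : Circ, |u x| ^ 3) + a * ∫ x : Circ, |u x|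

/-- `φ` minimizes the energy over all real-valued `u ∈ H^{α/2}` with `∫ u² = lam`. -/
structure IsConstrainedMinimizer (α a lam : ℝ) (φ : Circ → ℝ) : Prop where
  sobolev : InSobolev (α / 2) (toC φ)
  mass : ∫ x : Circ, φ x ^ 2 = lam
  minimal : ∀ u : Circ → ℝ, InSobolev (α / 2) (toC u) → ∫ x : Circ, u x ^ 2 = lam →
    energy α a φ ≤ energy α a u

/-- Bell-shaped: nonnegative, even, and non-increasing on `[0, 1]`. -/
structure IsBellShaped (φ : Circ → ℝ) : Prop where
  nonneg : ∀ x, 0 ≤ φ x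
  even : ∀ x, φ (-x) = φ x
  anti : AntitoneOn (fun x : ℝ => φ (x : Circ)) (Set.Icc 0 1)

/-- The Lagrange multiplier
`ω = (∫ φ³ - ∫ |Λ^{α/2} φ|² - a ∫ φ) / lam` of a constrained minimizer. -/
def multiplier (α a lam : ℝ) (φ : Circ → ℝ) : ℝ :=
  ((∫ x : Circ, φ x ^ 3) - kinetic α φ - a * ∫ x : Circ, φ x) / lam

/-- `L₊ h = Λ^α h + ω h - 2 φ h`. -/
def linPlus (α ω : ℝ) (φ : Circ → ℝ) (h : Circ → ℂ) : Circ → ℂ :=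
  fun x => (fracLap α h : Circ → ℂ) x + (ω : ℂ) * h x - 2 * (φ x : ℂ) * h x

/-- The kernel of `L₊` with domain `H^α`. -/
def kerLinPlus (α ω : ℝ) (φ : Circ → ℝ) : Set (Circ → ℂ) :=
  {h | InSobolev α h ∧ linPlus α ω φ h =ᵐ[volume] 0}

/-- For `f ∈ H^s` the coefficients of `Λ^s f` are square summable. -/
theorem memℓp_fracCoeff {s : ℝ} (hs : 0 ≤ s) {f : Circ → ℂ} (hf : InSobolev s f) :
    Memℓp (fracCoeff s f) 2 := by
  refine memℓp_gen ?_
  have hsum := hf.2.mul_left ((Real.pi ^ s) ^ 2)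
  refine Summable.of_nonneg_of_le (fun k => by positivity) (fun k => ?_) hsum
  have hk : |(k : ℝ)| ^ s ≤ ((1 + |(k : ℝ)| ^ 2) ^ (1 / 2 : ℝ)) ^ s := by
    refine Real.rpow_le_rpow (abs_nonneg _) ?_ hs
    rw [← Real.sqrt_eq_rpow]
    exact Real.le_sqrt_of_sq_le (by linarith)
  have hk2 : (|(k : ℝ)| ^ s) ^ 2 ≤ (1 + |(k : ℝ)| ^ 2) ^ s := by
    refine (pow_le_pow_left₀ (by positivity) hk 2).trans (le_of_eq ?_)
    rw [← Real.rpow_mul (by positivity), ← Real.rpow_natCast, ← Real.rpow_mul (by positivity)]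
    congr 1
    push_cast
    ring
  have h1 : ‖fracCoeff s f k‖ = Real.pi ^ s * |(k : ℝ)| ^ s * ‖fourierCoeff f k‖ := by
    rw [fracCoeff, norm_mul, Complex.norm_real, Real.norm_of_nonneg (by positivity),
      Real.mul_rpow Real.pi_pos.le (abs_nonneg _)]
  have h2 : ‖fracCoeff s f k‖ ^ (2 : ENNReal).toReal = ‖fracCoeff s f k‖ ^ 2 := by
    rw [ENNReal.toReal_ofNat]
    exact Real.rpow_natCast _ 2
  rw [h2, h1, mul_pow, mul_pow, mul_assoc]
  gcongr

/-- For `f ∈ H^s` the function `Λ^s f` has Fourier coefficients `(π|k|)^s f̂(k)`. -/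
theorem fourierCoeff_fracLap {s : ℝ} (hs : 0 ≤ s) {f : Circ → ℂ} (hf : InSobolev s f) (k : ℤ) :
    fourierCoeff (fracLap s f : Circ → ℂ) k
      = (((Real.pi * |(k : ℝ)|) ^ s : ℝ) : ℂ) * fourierCoeff f k := by
  rw [fracLap, dif_pos (memℓp_fracCoeff hs hf), ← fourierBasis_repr,
    LinearIsometryEquiv.apply_symm_apply]
  rfl

end FracWave

end

noncomputable section

namespace FracWave

open AddCircle Filter Topology ComplexConjugate

/-! Real and imaginary parts of a kernel element are again kernel elements, so let `r` be real with
`L₊ r = 0` and suppose `∫ φ r ≠ 0`. Minimality is exploited along circles on the sphere of mass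
`lam` through `φ` (`IsConstrainedMinimizer.expansion`): the linear term gives the Euler–Lagrange
equation, the quadratic term gives `⟨L₊ w, w⟩ ≥ 0` for admissible `w ⊥ φ`.

If `a ≤ 0`, every `w ⊥ φ` is admissible. Since `r` is in the kernel and not orthogonal to `φ`,
subtracting a multiple of `r` makes any function orthogonal to `φ` without changing the form, so `L₊
≥ 0` everywhere. But the Euler–Lagrange equation and the evenness of `φ` make the form vanish at `ψ
= φ(· + t) - φ`. A zero of a nonnegative form lies in its kernel; pairing `ψ` with `1` gives `∫ φ ψ
= 0`, hence `ψ = 0`. So `φ` is constant, and then `r` forces `a = -lam / 2`, the excluded case.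

If `a > 0`, the term `|u|` is not smooth at `0`, and the second variation is available only when the
perturbed function stays nonnegative. Here `⟨L₊ φ, φ⟩ < 0`, and this sign survives in `w = φ - c (r
+ τ)` with `τ` small and `c` making `w ⊥ φ`. The shift `τ` makes `r + τ` nonzero at `x = 1`, the
only point near which a bell-shaped `φ > 0` can degenerate. With the right sign, `±w` pushes upwards
there and is therefore admissible, a contradiction. -/

/-! ### Fourier coefficients and Parseval's identity. -/

theorem ae_haarAddCircle_eq : ae (haarAddCircle (T := 2)) = ae (volume : Measure Circ) := by
  rw [volume_eq_smul_haarAddCircle, Measure.ae_ennreal_smul_measure_eq (by simp)]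

/-- Parseval's identity on the circle of length `2`. -/
theorem hasSum_fourierCoeff_mul_conj {f g : Circ → ℂ} (hf : MemLp f 2 volume)
    (hg : MemLp g 2 volume) :
    HasSum (fun k => fourierCoeff f k * conj (fourierCoeff g k))
      ((1 / 2 : ℂ) * ∫ x, f x * conj (g x)) := by
  have h := (fourierBasis (T := 2)).hasSum_inner_mul_inner hg.haarAddCircle.toLp
    hf.haarAddCircle.toLp
  have h1 : ∀ (u : Circ → ℂ) (hu : MemLp u 2 volume) (k : ℤ),
      inner ℂ ((fourierBasis (T := 2)) k) hu.haarAddCircle.toLp = fourierCoeff u k := by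
    intro u hu k
    rw [← HilbertBasis.repr_apply_apply, fourierBasis_repr]
    exact congrFun (fourierCoeff_congr_ae hu.haarAddCircle.coeFn_toLp) k
  have h2 : inner ℂ hg.haarAddCircle.toLp hf.haarAddCircle.toLp
      = (1 / 2 : ℂ) * ∫ x, f x * conj (g x) := by
    rw [L2.inner_def]
    have : ∫ x, f x * conj (g x) ∂(haarAddCircle (T := 2))
        = (1 / 2 : ℂ) * ∫ x, f x * conj (g x) := by
      rw [integral_haarAddCircle, Complex.real_smul]
      norm_num
    rw [← this]
    refine integral_congr_ae ?_
    filter_upwards [hf.haarAddCircle.coeFn_toLp, hg.haarAddCircle.coeFn_toLp] with x hx hy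
    rw [hx, hy, RCLike.inner_apply]
  rw [h2] at h
  have h3 : ∀ k, inner ℂ hg.haarAddCircle.toLp ((fourierBasis (T := 2)) k)
      * inner ℂ ((fourierBasis (T := 2)) k) hf.haarAddCircle.toLp
      = fourierCoeff f k * conj (fourierCoeff g k) := fun k => by
    rw [h1 f hf, ← inner_conj_symm, h1 g hg, mul_comm]
  simp only [h3] at h
  exact h

/-- The Fourier coefficients of a real function. -/
def ft (u : Circ → ℝ) (k : ℤ) : ℂ := fourierCoeff (toC u) k

theorem memLp_toC {u : Circ → ℝ} {p : ENNReal} : MemLp (toC u) p volume ↔ MemLp u p volume :=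
  ⟨fun h => by simpa [toC] using h.re, fun h => h.ofReal⟩

theorem integrable_haar {f : Circ → ℂ} (hf : Integrable f) : Integrable f haarAddCircle := by
  rw [← memLp_one_iff_integrable] at *
  exact hf.haarAddCircle

theorem fourierCoeff_add_mul {f g : Circ → ℂ} (hf : Integrable f) (hg : Integrable g) (c d : ℂ)
    (k : ℤ) : fourierCoeff (fun x => c * f x + d * g x) k
      = c * fourierCoeff f k + d * fourierCoeff g k := by
  have h := congrFun (fourierCoeff.add (integrable_haar (hf.const_mul c))
    (integrable_haar (hg.const_mul d))) k
  rw [Pi.add_apply, fourierCoeff.const_mul, fourierCoeff.const_mul] at h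
  exact h

theorem ft_add_mul {u v : Circ → ℝ} (hu : Integrable u) (hv : Integrable v) (c d : ℝ) (k : ℤ) :
    ft (fun x => c * u x + d * v x) k = c * ft u k + d * ft v k := by
  have h := fourierCoeff_add_mul (f := toC u) (g := toC v) hu.ofReal hv.ofReal c d k
  rw [ft, ft, ft, ← h]
  congr 1
  funext x
  simp [toC]

theorem fourierCoeff_conj (f : Circ → ℂ) (k : ℤ) :
    fourierCoeff (fun x => conj (f x)) k = conj (fourierCoeff f (-k)) := by
  rw [fourierCoeff, fourierCoeff, ← integral_conj]
  refine integral_congr_ae (ae_of_all _ fun x => ?_)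
  simp only [smul_eq_mul, map_mul, ← fourier_neg, neg_neg]

theorem hasSum_ft_mul_conj {u v : Circ → ℝ} (hu : MemLp u 2 volume) (hv : MemLp v 2 volume) :
    HasSum (fun k => (ft u k * conj (ft v k)).re) ((1 / 2) * ∫ x, u x * v x) := by
  have h := Complex.hasSum_re (hasSum_fourierCoeff_mul_conj (memLp_toC.2 hu) (memLp_toC.2 hv))
  have h1 : (1 / 2 : ℂ) * ∫ x, toC u x * conj (toC v x)
      = (((1 / 2) * ∫ x, u x * v x : ℝ) : ℂ) := by
    rw [Complex.ofReal_mul, ← integral_complex_ofReal]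
    simp [toC]
  rw [h1, Complex.ofReal_re] at h
  exact h

theorem ft_one (k : ℤ) : ft (fun _ => 1) k = if k = 0 then 1 else 0 := by
  have : toC (fun _ => 1) = (fourier 0 : C(Circ, ℂ)) := by
    funext x
    rw [fourier_zero]
    simp [toC]
  rw [ft, this, fourierCoeff_fourier]
  by_cases h : k = 0
  · subst h; simp
  · simp [h]

theorem ft_zero_eq {u : Circ → ℝ} : ft u 0 = ((1 / 2) * ∫ x, u x : ℝ) := by
  rw [ft, fourierCoeff, integral_haarAddCircle]
  simp only [neg_zero, fourier_zero, one_smul, toC]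
  rw [integral_complex_ofReal, Complex.real_smul]
  norm_num

theorem ft_translate (u : Circ → ℝ) (t : Circ) (k : ℤ) :
    ft (fun x => u (x + t)) k = fourier k t * ft u k := by
  rw [ft, ft, fourierCoeff, fourierCoeff, ← integral_const_mul]
  have h := integral_add_right_eq_self (μ := haarAddCircle (T := 2))
    (fun x => fourier k t * fourier (-k) x • toC u x) t
  rw [← h]
  refine integral_congr_ae (ae_of_all _ fun x => ?_)
  have h1 : fourier (-k) (x + t) = fourier (-k) x * fourier (-k) t := by
    simp only [fourier_apply, smul_add, toCircle_add, Circle.coe_mul]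
  have h2 : fourier k t * fourier (-k) t = 1 := by
    rw [← fourier_add, add_neg_cancel, fourier_zero]
  change _ • toC u (x + t) = _
  simp only [smul_eq_mul]
  rw [h1]
  linear_combination (-(fourier (-k) x) * toC u (x + t)) * h2

theorem norm_fourier_apply (k : ℤ) (t : Circ) : ‖fourier k t‖ = 1 := by
  rw [fourier_apply, Circle.norm_coe]

/-! ### Real Sobolev functions. -/

/-- The real Sobolev space `H^s`. -/
def RealSobolev (s : ℝ) (u : Circ → ℝ) : Prop := InSobolev s (toC u)

variable {s : ℝ} {u v w : Circ → ℝ}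

theorem RealSobolev.memLp_two (hu : RealSobolev s u) : MemLp u 2 volume := memLp_toC.1 hu.1

theorem RealSobolev.integrable (hu : RealSobolev s u) : Integrable u :=
  hu.memLp_two.integrable (by norm_num)

theorem InSobolev.add_mul {f g : Circ → ℂ} (hf : InSobolev s f) (hg : InSobolev s g) (c d : ℂ) :
    InSobolev s (fun x => c * f x + d * g x) := by
  refine ⟨(hf.1.const_mul c).add (hg.1.const_mul d), ?_⟩
  refine Summable.of_nonneg_of_le (fun k => by positivity) (fun k => ?_)
    ((hf.2.mul_left (2 * ‖c‖ ^ 2)).add (hg.2.mul_left (2 * ‖d‖ ^ 2)))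
  rw [fourierCoeff_add_mul (hf.1.integrable (by norm_num)) (hg.1.integrable (by norm_num))]
  have h1 := norm_add_le (c * fourierCoeff f k) (d * fourierCoeff g k)
  rw [norm_mul, norm_mul] at h1
  have h2 : ‖c * fourierCoeff f k + d * fourierCoeff g k‖ ^ 2
      ≤ 2 * ‖c‖ ^ 2 * ‖fourierCoeff f k‖ ^ 2 + 2 * ‖d‖ ^ 2 * ‖fourierCoeff g k‖ ^ 2 := by
    refine (pow_le_pow_left₀ (norm_nonneg _) h1 2).trans ?_
    nlinarith [sq_nonneg (‖c‖ * ‖fourierCoeff f k‖ - ‖d‖ * ‖fourierCoeff g k‖)]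
  have h3 : (0 : ℝ) ≤ (1 + |(k : ℝ)| ^ 2) ^ s := by positivity
  nlinarith [mul_le_mul_of_nonneg_left h2 h3]

theorem RealSobolev.add_mul (hu : RealSobolev s u) (hv : RealSobolev s v) (c d : ℝ) :
    RealSobolev s (fun x => c * u x + d * v x) := by
  have := InSobolev.add_mul hu hv c d
  unfold RealSobolev
  convert this using 2
  simp [toC]

theorem realSobolev_one : RealSobolev s (fun _ => 1) := by
  refine ⟨memLp_toC.2 (memLp_const 1), summable_of_ne_finset_zero (s := {0}) fun k hk => ?_⟩
  have := ft_one k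
  rw [ft] at this
  rw [this]
  simp at hk
  simp [hk]

theorem RealSobolev.translate (hu : RealSobolev s u) (t : Circ) :
    RealSobolev s (fun x => u (x + t)) := by
  refine ⟨memLp_toC.2 (hu.memLp_two.comp_measurePreserving
    (measurePreserving_add_right volume t)), ?_⟩
  convert hu.2 using 2 with k
  have := ft_translate u t k
  rw [ft, ft] at this
  rw [this, norm_mul, norm_fourier_apply, one_mul]

/-! ### The kinetic bilinear form. -/

/-- The polarization of `kinetic`. -/
def kin (α : ℝ) (u v : Circ → ℝ) : ℝ :=
  2 * ∑' k : ℤ, (Real.pi * |(k : ℝ)|) ^ α * (ft u k * conj (ft v k)).re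

variable {α : ℝ}

theorem summable_kin (hα : 0 < α) (hu : RealSobolev (α / 2) u) (hv : RealSobolev (α / 2) v) :
    Summable fun k : ℤ => (Real.pi * |(k : ℝ)|) ^ α * (ft u k * conj (ft v k)).re := by
  have h1 : ∀ {u : Circ → ℝ}, RealSobolev (α / 2) u →
      Summable fun k : ℤ => (Real.pi * |(k : ℝ)|) ^ α * ‖ft u k‖ ^ 2 := by
    intro u hu
    refine Summable.of_nonneg_of_le (fun k => by positivity) (fun k => ?_)
      (hu.2.mul_left (Real.pi ^ α))
    rw [Real.mul_rpow Real.pi_pos.le (abs_nonneg _), mul_assoc]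
    unfold ft
    gcongr
    calc |(k : ℝ)| ^ α = (|(k : ℝ)| ^ 2) ^ (α / 2) := by
          rw [← Real.rpow_natCast, ← Real.rpow_mul (abs_nonneg _)]
          congr 1
          push_cast
          ring
      _ ≤ _ := Real.rpow_le_rpow (by positivity) (by linarith) (by positivity)
  refine Summable.of_norm_bounded ((h1 hu).add (h1 hv)) fun k => ?_
  have h2 : |(ft u k * conj (ft v k)).re| ≤ ‖ft u k‖ ^ 2 + ‖ft v k‖ ^ 2 := by
    refine (Complex.abs_re_le_norm _).trans ?_
    rw [norm_mul, RCLike.norm_conj]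
    nlinarith [sq_nonneg (‖ft u k‖ - ‖ft v k‖), sq_nonneg (‖ft u k‖), sq_nonneg (‖ft v k‖)]
  have h3 : 0 ≤ (Real.pi * |(k : ℝ)|) ^ α := by positivity
  rw [Real.norm_eq_abs, abs_mul, abs_of_nonneg h3]
  nlinarith

theorem kin_comm (u v : Circ → ℝ) : kin α u v = kin α v u := by
  unfold kin
  congr 2
  funext k
  congr 1
  simp
  ring

theorem kin_add_mul_left (hα : 0 < α) (hu : RealSobolev (α / 2) u) (hv : RealSobolev (α / 2) v)
    (hw : RealSobolev (α / 2) w) (c d : ℝ) :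
    kin α (fun x => c * u x + d * v x) w = c * kin α u w + d * kin α v w := by
  have h := ((summable_kin hα hu hw).hasSum.mul_left (2 * c)).add
    ((summable_kin hα hv hw).hasSum.mul_left (2 * d))
  have h' := h.tsum_eq
  unfold kin
  rw [← tsum_mul_left]
  calc _ = _ := by
        refine (tsum_congr fun k => ?_).trans h'
        rw [ft_add_mul hu.integrable hv.integrable]
        simp
        ring
    _ = _ := by ring

theorem kin_add_mul_right (hα : 0 < α) (hu : RealSobolev (α / 2) u)
    (hv : RealSobolev (α / 2) v) (hw : RealSobolev (α / 2) w) (c d : ℝ) :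
    kin α w (fun x => c * u x + d * v x) = c * kin α w u + d * kin α w v := by
  rw [kin_comm, kin_add_mul_left hα hu hv hw, kin_comm u, kin_comm v]

theorem kin_add_mul_self (hα : 0 < α) (hu : RealSobolev (α / 2) u)
    (hv : RealSobolev (α / 2) v) (c d : ℝ) :
    kin α (fun x => c * u x + d * v x) (fun x => c * u x + d * v x)
      = c ^ 2 * kin α u u + 2 * c * d * kin α u v + d ^ 2 * kin α v v := by
  rw [kin_add_mul_left hα hu hv (hu.add_mul hv c d), kin_add_mul_right hα hu hv hu,
    kin_add_mul_right hα hu hv hv, kin_comm v u]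
  ring

theorem kin_one_right (hα : 0 < α) (u : Circ → ℝ) : kin α u (fun _ => 1) = 0 := by
  unfold kin
  rw [mul_eq_zero]
  right
  refine (tsum_congr fun k => ?_).trans tsum_zero
  rw [ft_one]
  by_cases h : k = 0
  · simp [h, Real.zero_rpow hα.ne']
  · simp [h]

theorem kin_translate (u v : Circ → ℝ) (t : Circ) :
    kin α (fun x => u (x + t)) (fun x => v (x + t)) = kin α u v := by
  unfold kin
  congr 2
  funext k
  congr 2
  have h : fourier k t * conj (fourier k t) = 1 := by
    rw [Complex.mul_conj, Complex.normSq_eq_norm_sq, norm_fourier_apply]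
    simp
  rw [ft_translate, ft_translate, map_mul]
  linear_combination (ft u k * conj (ft v k)) * h

/-- Parseval applied to `Λ^{α/2} u`. The factor `2` in `kin` is the length of the circle, the
coefficients being taken with respect to the normalized measure. -/
theorem kinetic_eq_kin (hα : 0 < α) (hu : RealSobolev (α / 2) u) : kinetic α u = kin α u u := by
  set F : Lp ℂ 2 (haarAddCircle (T := 2)) := fracLap (α / 2) (toC u) with hF
  have hm : MemLp F 2 volume := memLp_haarAddCircle_iff.1 (Lp.memLp F)
  have h := Complex.hasSum_re (hasSum_fourierCoeff_mul_conj hm hm)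
  have h1 : ∫ x, F x * conj (F x) = ((∫ x, ‖F x‖ ^ 2 : ℝ) : ℂ) := by
    rw [← integral_complex_ofReal]
    refine integral_congr_ae (ae_of_all _ fun x => ?_)
    simp [Complex.mul_conj, Complex.normSq_eq_norm_sq]
  rw [h1] at h
  have h2 : kinetic α u = 2 * ((1 / 2 : ℂ) * ((∫ x, ‖F x‖ ^ 2 : ℝ) : ℂ)).re := by
    rw [kinetic, ← hF]
    have : ((1 / 2 : ℂ) * ((∫ x, ‖F x‖ ^ 2 : ℝ) : ℂ)) = ((1 / 2 * ∫ x, ‖F x‖ ^ 2 : ℝ) : ℂ) := by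
      push_cast; ring
    rw [this, Complex.ofReal_re]
    ring
  rw [h2, ← h.tsum_eq, kin]
  congr 2
  funext k
  rw [hF, fourierCoeff_fracLap (by positivity) hu]
  have h3 : (Real.pi * |(k : ℝ)|) ^ α
      = (Real.pi * |(k : ℝ)|) ^ (α / 2) * (Real.pi * |(k : ℝ)|) ^ (α / 2) := by
    rw [← Real.mul_rpow (by positivity) (by positivity), ← pow_two, ← Real.rpow_natCast,
      ← Real.rpow_mul (by positivity)]
    congr 1
    push_cast
    ring
  rw [h3, map_mul, Complex.conj_ofReal]
  simp [ft]
  ring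

/-! ### Sobolev embeddings into `L⁴` and into the continuous functions. -/

/-- Young's convolution inequality `ℓ^{4/3} * ℓ^{4/3} ⊂ ℓ²` for finite sums. -/
theorem sum_sq_conv_le (S : Finset ℤ) (d : ℤ → ℝ) :
    ∑ n ∈ (S ×ˢ S).image (fun p => p.1 + p.2),
      (∑ p ∈ S ×ˢ S with p.1 + p.2 = n, d p.1 ^ 3 * d p.2 ^ 3) ^ 2 ≤ (∑ k ∈ S, d k ^ 4) ^ 3 := by
  set A := ∑ k ∈ S, d k ^ 4 with hA
  -- On the line `p.1 + p.2 = n` either coordinate determines the other, so a sum over it is a sum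
  -- over distinct elements of `S`.
  have hproj : ∀ (n : ℤ) (π : ℤ × ℤ → ℤ), (π = Prod.fst ∨ π = Prod.snd) →
      ∑ p ∈ S ×ˢ S with p.1 + p.2 = n, d (π p) ^ 4 ≤ A := by
    intro n π hπ
    have hinj : Set.InjOn π (((S ×ˢ S).filter fun p => p.1 + p.2 = n : Finset (ℤ × ℤ)) :
        Set (ℤ × ℤ)) := by
      intro p hp q hq hpq
      simp only [Finset.coe_filter, Finset.mem_product, Set.mem_ofPred_eq] at hp hq
      have h1 := hp.2
      have h2 := hq.2
      rcases hπ with rfl | rfl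
      · exact Prod.ext hpq (by linarith)
      · exact Prod.ext (by linarith) hpq
    rw [← Finset.sum_image (f := fun k => d k ^ 4) hinj]
    refine Finset.sum_le_sum_of_subset_of_nonneg (fun k hk => ?_) fun k _ _ => by positivity
    obtain ⟨p, hp, rfl⟩ := Finset.mem_image.1 hk
    simp only [Finset.mem_filter, Finset.mem_product] at hp
    rcases hπ with rfl | rfl
    · exact hp.1.1
    · exact hp.1.2
  have hfib : ∀ n, (∑ p ∈ S ×ˢ S with p.1 + p.2 = n, d p.1 ^ 3 * d p.2 ^ 3) ^ 2
      ≤ (∑ p ∈ S ×ˢ S with p.1 + p.2 = n, d p.1 ^ 4 * d p.2 ^ 4) * A := by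
    intro n
    -- Cauchy–Schwarz for the splitting `x³ y³ = (x² y²) (x y)`; the second factor costs at most `A`
    -- on each line.
    have h1 := Finset.sum_mul_sq_le_sq_mul_sq ((S ×ˢ S).filter fun p => p.1 + p.2 = n)
      (fun p => d p.1 ^ 2 * d p.2 ^ 2) (fun p => d p.1 * d p.2)
    have h2 : ∑ p ∈ S ×ˢ S with p.1 + p.2 = n, (d p.1 * d p.2) ^ 2 ≤ A := by
      have h3 := hproj n Prod.fst (Or.inl rfl)
      have h4 := hproj n Prod.snd (Or.inr rfl)
      have h5 : ∑ p ∈ S ×ˢ S with p.1 + p.2 = n, (d p.1 * d p.2) ^ 2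
          ≤ ∑ p ∈ S ×ˢ S with p.1 + p.2 = n, (1 / 2 * d p.1 ^ 4 + 1 / 2 * d p.2 ^ 4) :=
        Finset.sum_le_sum fun p _ => by nlinarith [sq_nonneg (d p.1 ^ 2 - d p.2 ^ 2)]
      rw [Finset.sum_add_distrib, ← Finset.mul_sum, ← Finset.mul_sum] at h5
      linarith
    calc _ = (∑ p ∈ S ×ˢ S with p.1 + p.2 = n, d p.1 ^ 2 * d p.2 ^ 2 * (d p.1 * d p.2)) ^ 2 := by
          congr 1
          exact Finset.sum_congr rfl fun p _ => by ring
      _ ≤ _ := h1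
      _ ≤ (∑ p ∈ S ×ˢ S with p.1 + p.2 = n, (d p.1 ^ 2 * d p.2 ^ 2) ^ 2) * A :=
          mul_le_mul_of_nonneg_left h2 (Finset.sum_nonneg fun p _ => by positivity)
      _ = _ := by
          congr 1
          exact Finset.sum_congr rfl fun p _ => by ring
  refine (Finset.sum_le_sum fun n _ => hfib n).trans (le_of_eq ?_)
  rw [← Finset.sum_mul, Finset.sum_fiberwise_of_maps_to
    (fun p hp => Finset.mem_image_of_mem _ hp), Finset.sum_product]
  simp_rw [← Finset.mul_sum, ← Finset.sum_mul]
  ring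

/-- The trigonometric polynomial with coefficients `c` on `S`. -/
def trigPoly (S : Finset ℤ) (c : ℤ → ℂ) : C(Circ, ℂ) := ∑ k ∈ S, c k • fourier k

theorem ContinuousMap.memLp_circ (f : C(Circ, ℂ)) (p : ENNReal) : MemLp f p volume :=
  (f.continuous.memLp_of_hasCompactSupport (HasCompactSupport.of_compactSpace _))

theorem fourierCoeff_trigPoly_sq (S : Finset ℤ) (c : ℤ → ℂ) (n : ℤ) :
    fourierCoeff (trigPoly S c * trigPoly S c : C(Circ, ℂ)) n
      = ∑ p ∈ S ×ˢ S with p.1 + p.2 = n, c p.1 * c p.2 := by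
  have h : ((trigPoly S c * trigPoly S c : C(Circ, ℂ)) : Circ → ℂ)
      = ∑ p ∈ S ×ˢ S, fun x => (c p.1 * c p.2) * (fourier (p.1 + p.2) : C(Circ, ℂ)) x := by
    funext x
    simp only [trigPoly, Finset.sum_mul_sum, ← Finset.sum_product', ContinuousMap.coe_mul,
      Pi.mul_apply, ContinuousMap.coe_sum, Finset.sum_apply, ContinuousMap.smul_apply,
      fourier_add, smul_eq_mul]
    exact Finset.sum_congr rfl fun p _ => by ring
  rw [h, fourierCoeff.sum, Finset.sum_apply, Finset.sum_filter]
  · refine Finset.sum_congr rfl fun p _ => ?_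
    rw [fourierCoeff.const_mul, fourierCoeff_fourier]
    by_cases hn : p.1 + p.2 = n
    · simp [hn]
    · simp [hn, Ne.symm hn]
  · intro p _
    exact integrable_haar
      (((ContinuousMap.memLp_circ _ 1).integrable le_rfl).const_mul _)

/-- The fourth power of the `L⁴` norm is the squared `L²` norm of the square, whose coefficients are
a convolution, so Parseval and Young apply. Writing `‖c k‖ = d k ^ 3` turns the `ℓ^{4/3}` sum into
one of integer powers. -/
theorem integral_trigPoly_pow_four_le (S : Finset ℤ) (c : ℤ → ℂ) (d : ℤ → ℝ)
    (hd : ∀ k, ‖c k‖ = d k ^ 3) :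
    ∫ x, ‖trigPoly S c x‖ ^ 4 ≤ 2 * (∑ k ∈ S, d k ^ 4) ^ 3 := by
  set P : C(Circ, ℂ) := trigPoly S c * trigPoly S c with hP
  have hm := ContinuousMap.memLp_circ P 2
  have h := Complex.hasSum_re (hasSum_fourierCoeff_mul_conj hm hm)
  have h1 : (1 / 2 : ℂ) * ∫ x, P x * conj (P x) = ((1 / 2 * ∫ x, ‖trigPoly S c x‖ ^ 4 : ℝ) : ℂ) := by
    rw [Complex.ofReal_mul, ← integral_complex_ofReal]
    congr 1
    · simp
    · refine integral_congr_ae (ae_of_all _ fun x => ?_)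
      simp only [Complex.mul_conj, Complex.normSq_eq_norm_sq, hP, ContinuousMap.mul_apply, norm_mul]
      push_cast
      ring
  rw [h1, Complex.ofReal_re] at h
  have hk : ∀ n, (fourierCoeff P n * conj (fourierCoeff P n)).re
      = ‖∑ p ∈ S ×ˢ S with p.1 + p.2 = n, c p.1 * c p.2‖ ^ 2 := by
    intro n
    rw [hP, fourierCoeff_trigPoly_sq, Complex.mul_conj, Complex.normSq_eq_norm_sq,
      Complex.ofReal_re]
  simp only [hk] at h
  have h2 := h.unique (hasSum_sum_of_ne_finset_zero
    (s := (S ×ˢ S).image (fun p => p.1 + p.2)) fun n hn => by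
      rw [Finset.filter_eq_empty_iff.2]
      · simp
      · intro p hp h
        exact hn (Finset.mem_image.2 ⟨p, hp, h⟩))
  have h3 : ∑ n ∈ (S ×ˢ S).image (fun p => p.1 + p.2),
      ‖∑ p ∈ S ×ˢ S with p.1 + p.2 = n, c p.1 * c p.2‖ ^ 2 ≤ (∑ k ∈ S, d k ^ 4) ^ 3 := by
    refine le_trans (Finset.sum_le_sum fun n _ => ?_) (sum_sq_conv_le S d)
    refine pow_le_pow_left₀ (norm_nonneg _) ((norm_sum_le _ _).trans (le_of_eq ?_)) 2
    exact Finset.sum_congr rfl fun p _ => by rw [norm_mul, hd, hd]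
  linarith

theorem summable_bracket_rpow {α : ℝ} (hα : 1 / 2 < α) :
    Summable fun k : ℤ => ((1 : ℝ) + |(k : ℝ)| ^ 2) ^ (-α) := by
  have h : Summable fun k : ℤ => |(k : ℝ)| ^ (-(2 * α)) :=
    Real.summable_abs_int_rpow (by linarith)
  refine Summable.of_norm_bounded_eventually (g := fun k : ℤ => |(k : ℝ)| ^ (-(2 * α))) h ?_
  filter_upwards [(Set.finite_singleton (0 : ℤ)).compl_mem_cofinite] with k hk
  have hk0 : (0 : ℝ) < |(k : ℝ)| := abs_pos.2 (by exact_mod_cast hk)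
  rw [Real.norm_of_nonneg (by positivity)]
  calc _ ≤ (|(k : ℝ)| ^ 2) ^ (-α) :=
        Real.rpow_le_rpow_of_nonpos (by positivity) (by linarith) (by linarith)
    _ = _ := by
        rw [← Real.rpow_natCast, ← Real.rpow_mul hk0.le]
        congr 1
        push_cast
        ring

/-- The Sobolev embedding `H^s ⊂ L⁴` for `s > 1/4`. -/
theorem InSobolev.memLp_four {α : ℝ} (hα : 1 / 2 < α) {f : Circ → ℂ} (hf : InSobolev (α / 2) f) :
    MemLp f 4 volume := by
  set c : ℤ → ℂ := fourierCoeff f with hc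
  set d : ℤ → ℝ := fun k => ‖c k‖ ^ (1 / 3 : ℝ) with hd
  have hd0 : ∀ k, 0 ≤ d k := fun k => by positivity
  have hdc : ∀ k, ‖c k‖ = d k ^ 3 := fun k => by
    rw [hd, ← Real.rpow_natCast, ← Real.rpow_mul (norm_nonneg _)]
    norm_num
  have hsum : Summable fun k => d k ^ 4 := by
    refine Summable.of_nonneg_of_le (fun k => by positivity) (fun k => ?_)
      (hf.2.add (summable_bracket_rpow hα))
    set b : ℝ := 1 + |(k : ℝ)| ^ 2
    have hb : 0 < b := by positivity
    set y : ℝ := b ^ (-α / 3) with hy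
    have hy0 : 0 < y := by positivity
    have e1 : b ^ (-α) = y ^ 3 := by
      rw [hy, ← Real.rpow_natCast, ← Real.rpow_mul hb.le]
      congr 1
      push_cast
      ring
    set z : ℝ := b ^ (α / 6) with hz
    have hz0 : 0 < z := by positivity
    have e2 : b ^ (α / 2) = z ^ 3 := by
      rw [hz, ← Real.rpow_natCast, ← Real.rpow_mul hb.le]
      congr 1
      push_cast
      ring
    have e3 : z ^ 2 * y = 1 := by
      rw [hz, hy, ← Real.rpow_natCast, ← Real.rpow_mul hb.le, ← Real.rpow_add hb]
      have : α / 6 * ((2 : ℕ) : ℝ) + -α / 3 = 0 := by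
        push_cast
        ring
      rw [this, Real.rpow_zero]
    rw [← hc, e1, e2, hdc k]
    -- Young's inequality `x² y ≤ x³ + y³`: here `x³` is the Sobolev weight `b ^ (α / 2) * ‖c k‖ ^
    -- 2` and `y³ = b ^ (-α)`, both summable.
    have e4 : d k ^ 4 = (z * d k ^ 2) ^ 2 * y := by linear_combination (-(d k ^ 4)) * e3
    have e5 : z ^ 3 * (d k ^ 3) ^ 2 = (z * d k ^ 2) ^ 3 := by ring
    rw [e4, e5]
    set x := z * d k ^ 2
    have hx0 : 0 ≤ x := by positivity
    rcases le_total x y with h | h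
    · nlinarith [mul_le_mul h h hx0 hy0.le, pow_nonneg hx0 3]
    · nlinarith [sq_nonneg x, pow_nonneg hy0.le 3]
  set F : Lp ℂ 2 (haarAddCircle (T := 2)) := hf.1.haarAddCircle.toLp with hF
  have hFc : fourierCoeff F = c := fourierCoeff_congr_ae hf.1.haarAddCircle.coeFn_toLp
  have hsF := hasSum_fourier_series_L2 F
  have hlim : Tendsto (fun n : ℕ => (ContinuousMap.toLp 2 haarAddCircle ℂ)
      (trigPoly (Finset.Icc (-(n : ℤ)) n) c)) atTop (𝓝 F) := by
    have h1 : Tendsto (fun n : ℕ => Finset.Icc (-(n : ℤ)) n) atTop atTop := by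
      refine tendsto_atTop_finset_of_monotone (fun m n h => Finset.Icc_subset_Icc (by simpa)
        (by simpa)) fun k => ⟨k.natAbs, ?_⟩
      simp only [Finset.mem_Icc]
      omega
    refine (hsF.comp h1).congr fun n => ?_
    simp only [trigPoly, Function.comp, map_sum, map_smul, hFc]
  have hmeas := tendstoInMeasure_of_tendsto_Lp hlim
  obtain ⟨ns, -, hns⟩ := hmeas.exists_seq_tendsto_ae
  have hae : ∀ᵐ x ∂(volume : Measure Circ), Tendsto
      (fun n => trigPoly (Finset.Icc (-(ns n : ℤ)) (ns n)) c x) atTop (𝓝 (f x)) := by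
    rw [← ae_haarAddCircle_eq]
    have hall := ae_all_iff.2 fun n : ℕ => ContinuousMap.coeFn_toLp (p := 2) (𝕜 := ℂ)
      (haarAddCircle (T := 2)) (trigPoly (Finset.Icc (-(ns n : ℤ)) (ns n)) c)
    filter_upwards [hns, hall, hf.1.haarAddCircle.coeFn_toLp] with x h1 h2 h3
    rw [← h3]
    exact h1.congr fun n => h2 n
  -- Fatou's lemma along an almost everywhere convergent subsequence of the Fourier partial sums,
  -- which are bounded in `L⁴`.
  have hle := Lp.eLpNorm_lim_le_liminf_eLpNorm (p := 4)
    (fun n => (trigPoly (Finset.Icc (-(ns n : ℤ)) (ns n)) c).continuous.aestronglyMeasurable)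
    f hae
  refine ⟨hf.1.1, hle.trans_lt ?_⟩
  set C : ℝ := (2 * (∑' k, d k ^ 4) ^ 3) ^ (1 / 4 : ℝ) with hC
  have hbound : ∀ n : ℕ, eLpNorm (trigPoly (Finset.Icc (-(ns n : ℤ)) (ns n)) c) 4 volume
      ≤ ENNReal.ofReal C := by
    intro n
    rw [MemLp.eLpNorm_eq_integral_rpow_norm (by norm_num) (by norm_num)
      (ContinuousMap.memLp_circ _ 4)]
    refine ENNReal.ofReal_le_ofReal ?_
    have h4 : (4 : ENNReal).toReal = 4 := by norm_num
    rw [h4, hC, one_div]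
    have hnn : ∀ x, ‖trigPoly (Finset.Icc (-(ns n : ℤ)) (ns n)) c x‖ ^ (4 : ℝ)
        = ‖trigPoly (Finset.Icc (-(ns n : ℤ)) (ns n)) c x‖ ^ 4 := fun x => by
      exact_mod_cast Real.rpow_natCast _ 4
    simp only [hnn]
    refine Real.rpow_le_rpow (integral_nonneg fun x => by positivity) ?_ (by norm_num)
    refine (integral_trigPoly_pow_four_le _ c d hdc).trans ?_
    have := hsum.sum_le_tsum (Finset.Icc (-(ns n : ℤ)) (ns n)) fun k _ => by positivity
    have h0 : 0 ≤ ∑ k ∈ Finset.Icc (-(ns n : ℤ)) (ns n), d k ^ 4 :=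
      Finset.sum_nonneg fun k _ => by positivity
    gcongr
  calc _ ≤ ENNReal.ofReal C := by
        refine liminf_le_of_le (by isBoundedDefault) fun b hb => ?_
        obtain ⟨n, hn⟩ := hb.exists
        exact hn.trans (hbound n)
    _ < ⊤ := ENNReal.ofReal_lt_top

/-- The Sobolev embedding `H^s ⊂ C` for `s > 1/2`. -/
theorem InSobolev.exists_continuous {α : ℝ} (hα : 1 / 2 < α) {f : Circ → ℂ}
    (hf : InSobolev α f) : ∃ g : C(Circ, ℂ), f =ᵐ[volume] g := by
  have hsum : Summable fun k : ℤ => ‖fourierCoeff f k‖ := by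
    refine Summable.of_nonneg_of_le (fun k => by positivity) (fun k => ?_)
      (hf.2.add (summable_bracket_rpow hα))
    set b : ℝ := 1 + |(k : ℝ)| ^ 2
    have hb : 0 < b := by positivity
    have e1 : b ^ α * b ^ (-α) = 1 := by
      rw [← Real.rpow_add hb, add_neg_cancel, Real.rpow_zero]
    have h1 : 0 < b ^ α := by positivity
    have h2 : 0 < b ^ (-α) := by positivity
    set x := ‖fourierCoeff f k‖
    have hx : 0 ≤ x := norm_nonneg _
    -- This is `x ≤ b ^ α * x ^ 2 + b ^ (-α)`: the first term suffices if `x * b ^ α ≥ 1`, the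
    -- second otherwise.
    by_contra! hlt
    have h3 : x ^ 2 * b ^ α < x := by nlinarith
    have hx0 : 0 < x := by
      rcases hx.eq_or_lt with h | h
      · rw [← h] at h3; norm_num at h3
      · exact h
    have h4 : x * b ^ α < 1 := by
      by_contra! h
      nlinarith
    have h5 : x < b ^ (-α) := by
      calc x = x * b ^ α * b ^ (-α) := by rw [mul_assoc, e1, mul_one]
        _ < 1 * b ^ (-α) := mul_lt_mul_of_pos_right h4 h2
        _ = _ := one_mul _
    nlinarith [sq_nonneg x]
  have hsumC : Summable fun k : ℤ => fourierCoeff f k • (fourier k : C(Circ, ℂ)) := by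
    refine Summable.of_norm (hsum.congr fun k => ?_)
    rw [norm_smul, fourier_norm, mul_one]
  refine ⟨∑' k : ℤ, fourierCoeff f k • (fourier k : C(Circ, ℂ)), ?_⟩
  set g := ∑' k : ℤ, fourierCoeff f k • (fourier k : C(Circ, ℂ))
  set F : Lp ℂ 2 (haarAddCircle (T := 2)) := hf.1.haarAddCircle.toLp with hF
  have hFc : fourierCoeff F = fourierCoeff f :=
    fourierCoeff_congr_ae hf.1.haarAddCircle.coeFn_toLp
  have h1 := (ContinuousMap.toLp (E := ℂ) 2 (haarAddCircle (T := 2)) ℂ).hasSum hsumC.hasSum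
  have h2 := hasSum_fourier_series_L2 F
  rw [hFc] at h2
  have h3 : ContinuousMap.toLp (E := ℂ) 2 (haarAddCircle (T := 2)) ℂ g = F := by
    refine h1.unique ?_
    convert h2 using 2 with k
    exact map_smul _ _ _
  rw [← ae_haarAddCircle_eq]
  refine hf.1.haarAddCircle.coeFn_toLp.symm.trans ?_
  rw [← hF, ← h3]
  exact ContinuousMap.coeFn_toLp _ _

/-! ### Integrability of products and expansion of integrals. -/

variable {a lam ω : ℝ} {φ r : Circ → ℝ}

theorem RealSobolev.memLp_four (hα : 1 / 2 < α) (hu : RealSobolev (α / 2) u) :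
    MemLp u 4 volume :=
  memLp_toC.1 (InSobolev.memLp_four hα hu)

theorem integrable_mul_two (hu : MemLp u 2 volume) (hv : MemLp v 2 volume) :
    Integrable fun x => u x * v x :=
  MemLp.integrable_mul hu hv

instance holderTriple_four_four_two : ENNReal.HolderTriple 4 4 2 := ⟨by
  have : (4 : ENNReal) = 2 * 2 := by norm_num
  rw [this, ENNReal.mul_inv (by simp) (by simp), ← mul_add, ENNReal.inv_two_add_inv_two, mul_one]⟩

theorem memLp_two_mul_four {f g : Circ → ℂ} (hf : MemLp f 4 volume) (hg : MemLp g 4 volume) :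
    MemLp (fun x => f x * g x) 2 volume :=
  hg.mul' hf

theorem integrable_mul_three (hu : MemLp u 4 volume) (hv : MemLp v 4 volume)
    (hw : MemLp w 4 volume) : Integrable fun x => u x * v x * w x :=
  integrable_mul_two (hv.mul' hu) (hw.mono_exponent (by norm_num))

theorem integral_add_mul (hu : Integrable u) (hv : Integrable v) (c d : ℝ) :
    ∫ x, (c * u x + d * v x) = c * (∫ x, u x) + d * ∫ x, v x := by
  rw [integral_add (hu.const_mul c) (hv.const_mul d), integral_const_mul, integral_const_mul]

theorem integral_mul_add_mul (hw : MemLp w 2 volume) (hu : MemLp u 2 volume)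
    (hv : MemLp v 2 volume) (c d : ℝ) :
    ∫ x, w x * (c * u x + d * v x) = c * (∫ x, w x * u x) + d * ∫ x, w x * v x := by
  rw [← integral_add_mul (integrable_mul_two hw hu) (integrable_mul_two hw hv)]
  congr 1
  funext x
  ring

theorem integral_add_mul_sq (hu : MemLp u 2 volume) (hv : MemLp v 2 volume) (c d : ℝ) :
    ∫ x, (c * u x + d * v x) ^ 2
      = c ^ 2 * (∫ x, u x ^ 2) + 2 * c * d * (∫ x, u x * v x) + d ^ 2 * ∫ x, v x ^ 2 := by
  have hs := (hu.const_mul c).add (hv.const_mul d)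
  have h := integral_mul_add_mul hs hu hv c d
  simp only [Pi.add_apply] at h
  have e : ∀ w : Circ → ℝ, MemLp w 2 volume →
      ∫ x, (c * u x + d * v x) * w x = c * (∫ x, u x * w x) + d * ∫ x, v x * w x := by
    intro w hw
    rw [← integral_add_mul (integrable_mul_two hu hw) (integrable_mul_two hv hw)]
    congr 1
    funext x
    ring
  rw [e u hu, e v hv] at h
  simp only [pow_two] at *
  rw [h]
  simp only [mul_comm (v _) (u _)]
  ring

theorem integral_add_mul_cube (hu : MemLp u 4 volume) (hv : MemLp v 4 volume) (c d : ℝ) :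
    ∫ x, (c * u x + d * v x) ^ 3
      = c ^ 3 * (∫ x, u x ^ 3) + 3 * c ^ 2 * d * (∫ x, u x ^ 2 * v x)
        + 3 * c * d ^ 2 * (∫ x, u x * v x ^ 2) + d ^ 3 * ∫ x, v x ^ 3 := by
  have e1 : Integrable fun x => u x ^ 3 :=
    (integrable_mul_three hu hu hu).congr (ae_of_all _ fun x => by ring)
  have e2 : Integrable fun x => u x ^ 2 * v x :=
    (integrable_mul_three hu hu hv).congr (ae_of_all _ fun x => by ring)
  have e3 : Integrable fun x => u x * v x ^ 2 :=
    (integrable_mul_three hu hv hv).congr (ae_of_all _ fun x => by ring)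
  have e4 : Integrable fun x => v x ^ 3 :=
    (integrable_mul_three hv hv hv).congr (ae_of_all _ fun x => by ring)
  have e12 : Integrable fun x => c ^ 3 * u x ^ 3 + 3 * c ^ 2 * d * (u x ^ 2 * v x) :=
    (e1.const_mul _).add (e2.const_mul _)
  have e123 : Integrable fun x => c ^ 3 * u x ^ 3 + 3 * c ^ 2 * d * (u x ^ 2 * v x)
      + 3 * c * d ^ 2 * (u x * v x ^ 2) := e12.add (e3.const_mul _)
  rw [← integral_const_mul, ← integral_const_mul, ← integral_const_mul, ← integral_const_mul,
    ← integral_add (e1.const_mul _) (e2.const_mul _), ← integral_add e12 (e3.const_mul _),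
    ← integral_add e123 (e4.const_mul _)]
  congr 1
  funext x
  ring

theorem integral_mul_add_mul_sq (hw : MemLp w 4 volume) (hu : MemLp u 4 volume)
    (hv : MemLp v 4 volume) (c d : ℝ) :
    ∫ x, w x * (c * u x + d * v x) ^ 2
      = c ^ 2 * (∫ x, w x * u x ^ 2) + 2 * c * d * (∫ x, w x * (u x * v x))
        + d ^ 2 * ∫ x, w x * v x ^ 2 := by
  have e1 : Integrable fun x => w x * u x ^ 2 :=
    (integrable_mul_three hw hu hu).congr (ae_of_all _ fun x => by ring)
  have e2 : Integrable fun x => w x * (u x * v x) :=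
    (integrable_mul_three hw hu hv).congr (ae_of_all _ fun x => by ring)
  have e3 : Integrable fun x => w x * v x ^ 2 :=
    (integrable_mul_three hw hv hv).congr (ae_of_all _ fun x => by ring)
  have e12 : Integrable fun x => c ^ 2 * (w x * u x ^ 2) + 2 * c * d * (w x * (u x * v x)) :=
    (e1.const_mul _).add (e2.const_mul _)
  rw [← integral_const_mul, ← integral_const_mul, ← integral_const_mul,
    ← integral_add (e1.const_mul _) (e2.const_mul _), ← integral_add e12 (e3.const_mul _)]
  congr 1
  funext x
  ring

/-! ### The energy and its expansion at the minimizer. -/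

/-- The energy without absolute values. -/
def cubicEnergy (α a : ℝ) (u : Circ → ℝ) : ℝ :=
  (1 / 2) * kin α u u - (1 / 3) * (∫ x, u x ^ 3) + a * ∫ x, u x

theorem energy_eq_cubicEnergy (hα : 0 < α) (hu : RealSobolev (α / 2) u) (h0 : ∀ x, 0 ≤ u x) :
    energy α a u = cubicEnergy α a u := by
  simp only [energy, cubicEnergy, kinetic_eq_kin hα hu, abs_of_nonneg (h0 _)]

theorem integrable_negPart (hu : Integrable u) : Integrable fun x => max (-(u x)) 0 :=
  hu.neg.pos_part

/-- Replacing `u³` by `|u|³` only lowers the energy, and `|u| = u + 2 u⁻`. Loss of positivity thus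
costs something only when `a > 0`. -/
theorem energy_le_cubicEnergy (hα : 1 / 2 < α) (hu : RealSobolev (α / 2) u) :
    energy α a u ≤ cubicEnergy α a u + 2 * max a 0 * ∫ x, max (-(u x)) 0 := by
  have h4 := hu.memLp_four hα
  have e1 : Integrable fun x => u x ^ 3 :=
    (integrable_mul_three h4 h4 h4).congr (ae_of_all _ fun x => by ring)
  have e2 : Integrable fun x => |u x| ^ 3 := e1.abs.congr (ae_of_all _ fun x => by simp [abs_pow])
  have h1 : ∫ x, u x ^ 3 ≤ ∫ x, |u x| ^ 3 :=
    integral_mono e1 e2 fun x => by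
      rw [← abs_pow]
      exact le_abs_self _
  have h2 : ∫ x, |u x| = (∫ x, u x) + 2 * ∫ x, max (-(u x)) 0 := by
    rw [← integral_const_mul, ← integral_add hu.integrable
      ((integrable_negPart hu.integrable).const_mul 2)]
    congr 1
    funext x
    rcases le_total 0 (u x) with h | h
    · rw [abs_of_nonneg h, max_eq_right (by linarith)]; ring
    · rw [abs_of_nonpos h, max_eq_left (by linarith)]; ring
  have h3 : 0 ≤ ∫ x, max (-(u x)) 0 := integral_nonneg fun x => le_max_right _ _
  rw [energy, cubicEnergy, kinetic_eq_kin (by linarith) hu, h2]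
  have h5 : a * (∫ x, max (-(u x)) 0) ≤ max a 0 * ∫ x, max (-(u x)) 0 :=
    mul_le_mul_of_nonneg_right (le_max_left _ _) h3
  linarith

/-- The bilinear form of `L₊`. -/
def bil (α ω : ℝ) (φ u v : Circ → ℝ) : ℝ :=
  kin α u v + ω * (∫ x, u x * v x) - 2 * ∫ x, φ x * (u x * v x)

/-- The quadratic form of `L₊`. -/
def quad (α ω : ℝ) (φ u : Circ → ℝ) : ℝ :=
  kin α u u + ω * (∫ x, u x ^ 2) - 2 * ∫ x, φ x * u x ^ 2

theorem bil_self : bil α ω φ u u = quad α ω φ u := by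
  simp only [bil, quad, pow_two]

theorem quad_add_mul (hα : 1 / 2 < α) (hφ : RealSobolev (α / 2) φ) (hu : RealSobolev (α / 2) u)
    (hv : RealSobolev (α / 2) v) (c d : ℝ) :
    quad α ω φ (fun x => c * u x + d * v x)
      = c ^ 2 * quad α ω φ u + 2 * c * d * bil α ω φ u v + d ^ 2 * quad α ω φ v := by
  simp only [quad, bil]
  rw [kin_add_mul_self (by linarith) hu hv, integral_add_mul_sq hu.memLp_two hv.memLp_two,
    integral_mul_add_mul_sq (hφ.memLp_four hα) (hu.memLp_four hα) (hv.memLp_four hα)]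
  ring

/-- The first variation of `cubicEnergy` at `φ`. -/
def firstVar (α a : ℝ) (φ w : Circ → ℝ) : ℝ :=
  kin α φ w - (∫ x, φ x ^ 2 * w x) + a * ∫ x, w x

theorem multiplier_mul (hα : 0 < α) (hφ : RealSobolev (α / 2) φ) (hlam : 0 < lam) :
    multiplier α a lam φ * lam = (∫ x, φ x ^ 3) - kin α φ φ - a * ∫ x, φ x := by
  rw [multiplier, kinetic_eq_kin hα hφ, div_mul_cancel₀ _ hlam.ne']

/-- The expansion of the energy along the circle through `φ` in the direction `w ⊥ φ` of the
sphere of mass `lam`, with the denominators cleared. -/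
theorem IsConstrainedMinimizer.expansion (hα : 1 / 2 < α) (hlam : 0 < lam)
    (hmin : IsConstrainedMinimizer α a lam φ) (h0 : ∀ x, 0 ≤ φ x)
    (hw : RealSobolev (α / 2) w) (horth : ∫ x, φ x * w x = 0) :
    ∃ R : ℝ → ℝ, Continuous R ∧ ∀ t : ℝ,
      0 ≤ (lam + (∫ x, w x ^ 2) * t ^ 2) ^ 2 * (2 * max a 0 *
          ∫ x, max (-((lam - (∫ x, w x ^ 2) * t ^ 2) * φ x + 2 * lam * t * w x)) 0)
        + 2 * lam ^ 3 * (t * firstVar α a φ w + t ^ 2 * quad α (multiplier α a lam φ) φ w)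
        + t ^ 3 * R t := by
  have hα0 : 0 < α := by linarith
  have hφ : RealSobolev (α / 2) φ := hmin.sobolev
  set G := ∫ x, w x ^ 2 with hG
  have hG0 : 0 ≤ G := integral_nonneg fun x => by positivity
  set k0 := kin α φ φ with hk0
  set k1 := kin α φ w with hk1
  set k2 := kin α w w with hk2
  set T0 := ∫ x, φ x ^ 3 with hT0
  set T1 := ∫ x, φ x ^ 2 * w x with hT1
  set T2 := ∫ x, φ x * w x ^ 2 with hT2
  set T3 := ∫ x, w x ^ 3 with hT3
  set m0 := ∫ x, φ x with hm0
  set m1 := ∫ x, w x with hm1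
  have hom := multiplier_mul (a := a) hα0 hφ hlam
  -- The terms of order at least three in the cleared energy difference, divided by `t ^ 3`.
  refine ⟨fun t => -2 * lam * G ^ 2 * t * k0 - 2 * lam * G ^ 2 * t ^ 2 * k1
    + 2 * lam ^ 2 * G * t * k2 + 2 / 3 * G ^ 3 * t ^ 3 * T0
    + (4 * lam ^ 2 * G - 2 * lam * G ^ 2 * t ^ 2) * T1 + 4 * lam ^ 2 * G * t * T2
    - 8 / 3 * lam ^ 3 * T3 + a * m0 * (-4 * lam * G ^ 2 * t - 2 * G ^ 3 * t ^ 3)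
    + a * m1 * (4 * lam ^ 2 * G + 2 * lam * G ^ 2 * t ^ 2), by fun_prop, fun t => ?_⟩
  set N := lam + G * t ^ 2 with hN
  have hN0 : 0 < N := by positivity
  -- Rational parametrization of the circle: `c ^ 2 * lam + d ^ 2 * G = lam`. With the cubic energy,
  -- multiplying by `N ^ 3` leaves a polynomial in `t` apart from the negative part.
  set c := (lam - G * t ^ 2) / N with hc
  set d := 2 * lam * t / N with hd
  have hu := hφ.add_mul hw c d
  have hcN : c * N = lam - G * t ^ 2 := div_mul_cancel₀ _ hN0.ne'
  have hdN : d * N = 2 * lam * t := div_mul_cancel₀ _ hN0.ne'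
  have hmass : ∫ x, (c * φ x + d * w x) ^ 2 = lam := by
    rw [integral_add_mul_sq hφ.memLp_two hw.memLp_two, hmin.mass, horth, ← hG]
    have : N ^ 2 * (c ^ 2 * lam + d ^ 2 * G) = N ^ 2 * lam := by
      calc _ = (c * N) ^ 2 * lam + (d * N) ^ 2 * G := by ring
        _ = _ := by rw [hcN, hdN, hN]; ring
    have := mul_left_cancel₀ (by positivity) this
    linarith
  have hle := (hmin.minimal _ hu hmass).trans (energy_le_cubicEnergy hα hu)
  rw [energy_eq_cubicEnergy hα0 hφ h0, cubicEnergy, cubicEnergy,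
    kin_add_mul_self hα0 hφ hw, integral_add_mul_cube (hφ.memLp_four hα) (hw.memLp_four hα),
    integral_add_mul hφ.integrable hw.integrable, ← hk0, ← hk1, ← hk2, ← hT0, ← hT1, ← hT2,
    ← hT3, ← hm0, ← hm1] at hle
  set P := ∫ x, max (-((lam - G * t ^ 2) * φ x + 2 * lam * t * w x)) 0 with hP
  have hPN : N * ∫ x, max (-(c * φ x + d * w x)) 0 = P := by
    rw [hP, ← integral_const_mul]
    congr 1
    funext x
    rw [← hcN, ← hdN, mul_max_of_nonneg _ _ hN0.le, mul_zero]
    congr 1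
    ring
  have hle' := mul_le_mul_of_nonneg_left hle (pow_pos hN0 3).le
  rw [firstVar, quad, ← hk1, ← hk2, ← hG, ← hT1, ← hT2, ← hm1]
  set Q := ∫ x, max (-(c * φ x + d * w x)) 0
  have e : N ^ 3 * (1 / 2 * (c ^ 2 * k0 + 2 * c * d * k1 + d ^ 2 * k2)
      - 1 / 3 * (c ^ 3 * T0 + 3 * c ^ 2 * d * T1 + 3 * c * d ^ 2 * T2 + d ^ 3 * T3)
      + a * (c * m0 + d * m1) + 2 * max a 0 * Q)
      = N * (1 / 2 * ((c * N) ^ 2 * k0 + 2 * (c * N) * (d * N) * k1 + (d * N) ^ 2 * k2))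
      - 1 / 3 * ((c * N) ^ 3 * T0 + 3 * (c * N) ^ 2 * (d * N) * T1
        + 3 * (c * N) * (d * N) ^ 2 * T2 + (d * N) ^ 3 * T3)
      + a * N ^ 2 * ((c * N) * m0 + (d * N) * m1) + N ^ 2 * (2 * max a 0 * (N * Q)) := by ring
  rw [e, hcN, hdN, hPN] at hle'
  rw [← sub_nonneg] at hle'
  refine hle'.trans (le_of_eq ?_)
  rw [hN]
  linear_combination (-(2 * lam ^ 2 * G * t ^ 2)) * hom

/-! ### First and second order conditions. -/

theorem nonneg_of_expansion_one {A d q : ℝ} (hA : 0 < A) {R E : ℝ → ℝ} (hR : Continuous R)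
    (hE : Tendsto (fun t => E t / t) (𝓝[>] 0) (𝓝 0))
    (h : ∀ᶠ t in 𝓝[>] (0 : ℝ), 0 ≤ E t + A * (t * d + t ^ 2 * q) + t ^ 3 * R t) : 0 ≤ d := by
  have h1 : Tendsto (fun t => A * (d + t * q) + t ^ 2 * R t) (𝓝[>] 0)
      (𝓝 (A * (d + 0 * q) + 0 ^ 2 * R 0)) :=
    (Continuous.tendsto (by fun_prop) 0).mono_left nhdsWithin_le_nhds
  have h2 : 0 ≤ 0 + (A * (d + 0 * q) + 0 ^ 2 * R 0) := by
    refine ge_of_tendsto (hE.add h1) ?_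
    filter_upwards [h, self_mem_nhdsWithin] with t ht ht0
    have ht0 : 0 < t := ht0
    have e : E t / t + (A * (d + t * q) + t ^ 2 * R t)
        = (E t + A * (t * d + t ^ 2 * q) + t ^ 3 * R t) / t := by
      field_simp
      ring
    rw [e]
    positivity
  have h3 : 0 ≤ A * d := by linarith
  exact nonneg_of_mul_nonneg_right h3 hA

theorem nonneg_of_expansion_two {A q : ℝ} (hA : 0 < A) {R : ℝ → ℝ} (hR : Continuous R)
    (h : ∀ᶠ t in 𝓝[>] (0 : ℝ), 0 ≤ A * (t ^ 2 * q) + t ^ 3 * R t) : 0 ≤ q := by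
  have h1 : Tendsto (fun t => A * q + t * R t) (𝓝[>] 0) (𝓝 (A * q + 0 * R 0)) :=
    (Continuous.tendsto (by fun_prop) 0).mono_left nhdsWithin_le_nhds
  have h2 : 0 ≤ A * q + 0 * R 0 := by
    refine ge_of_tendsto h1 ?_
    filter_upwards [h, self_mem_nhdsWithin] with t ht ht0
    have ht0 : 0 < t := ht0
    have e : A * q + t * R t = (A * (t ^ 2 * q) + t ^ 3 * R t) / t ^ 2 := by
      field_simp
    rw [e]
    positivity
  have h3 : 0 ≤ A * q := by linarith
  exact nonneg_of_mul_nonneg_right h3 hA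

/-- Where `φ x > 0` the perturbed value is positive for small `t`, and the negative part over `t` is
at most `2 * lam * |w x|` because `φ ≥ 0`; dominated convergence applies. Hence the non-smooth term
does not affect the first order condition, whatever the direction `w`. -/
theorem tendsto_integral_negPart_div (hlam : 0 < lam) (hφ : MemLp φ 2 volume)
    (hw : MemLp w 2 volume) (h0 : ∀ x, 0 ≤ φ x) (hpos : ∀ᵐ x, 0 < φ x) (G : ℝ) :
    Tendsto (fun t => (∫ x, max (-((lam - G * t ^ 2) * φ x + 2 * lam * t * w x)) 0) / t)
      (𝓝[>] 0) (𝓝 0) := by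
  have hsmall : ∀ᶠ t in 𝓝[>] (0 : ℝ), lam / 2 < lam - G * t ^ 2 := by
    refine Tendsto.eventually_const_lt (v := lam) (by linarith) ?_
    have : Tendsto (fun t : ℝ => lam - G * t ^ 2) (𝓝 0) (𝓝 (lam - G * 0 ^ 2)) :=
      Continuous.tendsto (by fun_prop) 0
    simp only [ne_eq, OfNat.ofNat_ne_zero, not_false_eq_true, zero_pow, mul_zero, sub_zero] at this
    exact this.mono_left nhdsWithin_le_nhds
  have key : Tendsto (fun t => ∫ x, (max (-((lam - G * t ^ 2) * φ x + 2 * lam * t * w x)) 0) / t)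
      (𝓝[>] 0) (𝓝 (∫ _ : Circ, (0 : ℝ))) := by
    refine tendsto_integral_filter_of_dominated_convergence (fun x => 2 * lam * |w x|) ?_ ?_ ?_ ?_
    · refine Eventually.of_forall fun t => ?_
      have : Integrable fun x => (lam - G * t ^ 2) * φ x + 2 * lam * t * w x :=
        ((hφ.integrable (by norm_num)).const_mul _).add ((hw.integrable (by norm_num)).const_mul _)
      exact ((integrable_negPart this).div_const t).aestronglyMeasurable
    · filter_upwards [hsmall, self_mem_nhdsWithin] with t ht ht0
      have ht0 : 0 < t := ht0
      refine ae_of_all _ fun x => ?_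
      rw [Real.norm_of_nonneg (div_nonneg (le_max_right _ _) ht0.le), div_le_iff₀ ht0]
      refine max_le ?_ (by positivity)
      have h1 : 0 ≤ (lam - G * t ^ 2) * φ x := mul_nonneg (by linarith) (h0 x)
      have h2 := mul_le_mul_of_nonneg_left (neg_abs_le (w x)) (by positivity : 0 ≤ 2 * lam * t)
      linarith
    · exact (hw.integrable (by norm_num)).abs.const_mul _
    · filter_upwards [hpos] with x hx
      refine tendsto_const_nhds.congr' ?_
      have : ∀ᶠ t in 𝓝[>] (0 : ℝ), 0 < (lam - G * t ^ 2) * φ x + 2 * lam * t * w x := by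
        have h1 : Tendsto (fun t : ℝ => (lam - G * t ^ 2) * φ x + 2 * lam * t * w x) (𝓝[>] 0)
            (𝓝 ((lam - G * 0 ^ 2) * φ x + 2 * lam * 0 * w x)) :=
          (Continuous.tendsto (by fun_prop) 0).mono_left nhdsWithin_le_nhds
        refine h1.eventually_const_lt ?_
        have := mul_pos hlam hx
        simpa using this
      filter_upwards [this] with t ht
      rw [max_eq_right (by linarith), zero_div]
  simp only [integral_zero, integral_div] at key
  exact key

theorem IsConstrainedMinimizer.firstVar_nonneg (hα : 1 / 2 < α) (hlam : 0 < lam)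
    (hmin : IsConstrainedMinimizer α a lam φ) (h0 : ∀ x, 0 ≤ φ x)
    (hpos : 0 < a → ∀ᵐ x, 0 < φ x)
    (hw : RealSobolev (α / 2) w) (horth : ∫ x, φ x * w x = 0) : 0 ≤ firstVar α a φ w := by
  obtain ⟨R, hR, h⟩ := hmin.expansion hα hlam h0 hw horth
  refine nonneg_of_expansion_one (by positivity) hR ?_ (Eventually.of_forall h)
  rcases le_or_gt a 0 with ha | ha
  · simp [max_eq_right ha]
  · have hφ : RealSobolev (α / 2) φ := hmin.sobolev
    have h1 := tendsto_integral_negPart_div hlam hφ.memLp_two hw.memLp_two h0 (hpos ha)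
      (∫ x, w x ^ 2)
    set G := ∫ x, w x ^ 2
    have h2 : Tendsto (fun t : ℝ => (lam + G * t ^ 2) ^ 2 * (2 * max a 0)) (𝓝[>] 0)
        (𝓝 ((lam + G * 0 ^ 2) ^ 2 * (2 * max a 0))) :=
      (Continuous.tendsto (by fun_prop) 0).mono_left nhdsWithin_le_nhds
    have h3 := h2.mul h1
    rw [mul_zero] at h3
    refine h3.congr fun t => ?_
    ring

theorem firstVar_add_mul (hα : 1 / 2 < α) (hφ : RealSobolev (α / 2) φ)
    (hu : RealSobolev (α / 2) u) (hv : RealSobolev (α / 2) v) (c d : ℝ) :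
    firstVar α a φ (fun x => c * u x + d * v x)
      = c * firstVar α a φ u + d * firstVar α a φ v := by
  have hsq : MemLp (fun x => φ x ^ 2) 2 volume := by
    simpa only [pow_two] using (hφ.memLp_four hα).mul' (r := 2) (hφ.memLp_four hα)
  simp only [firstVar]
  rw [kin_add_mul_right (by linarith) hu hv hφ, integral_add_mul hu.integrable hv.integrable,
    integral_mul_add_mul hsq hu.memLp_two hv.memLp_two]
  ring

theorem IsConstrainedMinimizer.firstVar_eq_zero (hα : 1 / 2 < α) (hlam : 0 < lam)
    (hmin : IsConstrainedMinimizer α a lam φ) (h0 : ∀ x, 0 ≤ φ x)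
    (hpos : 0 < a → ∀ᵐ x, 0 < φ x)
    (hw : RealSobolev (α / 2) w) (horth : ∫ x, φ x * w x = 0) : firstVar α a φ w = 0 := by
  refine le_antisymm ?_ (hmin.firstVar_nonneg hα hlam h0 hpos hw horth)
  have hφ : RealSobolev (α / 2) φ := hmin.sobolev
  have h1 := hmin.firstVar_nonneg hα hlam h0 hpos (hw.add_mul hw (-1) 0) (by
    rw [integral_mul_add_mul hφ.memLp_two hw.memLp_two hw.memLp_two, horth]
    ring)
  rw [firstVar_add_mul hα hφ hw hw] at h1
  linarith

/-- The Euler–Lagrange equation. -/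
theorem IsConstrainedMinimizer.euler_lagrange (hα : 1 / 2 < α) (hlam : 0 < lam)
    (hmin : IsConstrainedMinimizer α a lam φ) (h0 : ∀ x, 0 ≤ φ x)
    (hpos : 0 < a → ∀ᵐ x, 0 < φ x) (hw : RealSobolev (α / 2) w) :
    kin α φ w = (∫ x, φ x ^ 2 * w x) - a * (∫ x, w x)
      - multiplier α a lam φ * ∫ x, φ x * w x := by
  have hφ : RealSobolev (α / 2) φ := hmin.sobolev
  have hom := multiplier_mul (a := a) (by linarith) hφ hlam
  have hmass : ∫ x, φ x * φ x = lam := by simpa only [pow_two] using hmin.mass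
  -- The first variation vanishes at `lam` times the projection of `w` onto `φ^⊥`; in the direction
  -- `φ` it equals `-ω * lam` by the definition of the multiplier.
  have h1 := hmin.firstVar_eq_zero hα hlam h0 hpos (hw.add_mul hφ lam (-∫ x, φ x * w x)) (by
    rw [integral_mul_add_mul hφ.memLp_two hw.memLp_two hφ.memLp_two, hmass]
    ring)
  rw [firstVar_add_mul hα hφ hw hφ, firstVar, firstVar] at h1
  have e : ∫ x, φ x ^ 2 * φ x = ∫ x, φ x ^ 3 := by
    congr 1
  rw [e] at h1
  have h2 : lam * (kin α φ w) = lam * ((∫ x, φ x ^ 2 * w x) - a * (∫ x, w x)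
      - multiplier α a lam φ * ∫ x, φ x * w x) := by
    linear_combination h1 + (∫ x, φ x * w x) * hom
  exact mul_left_cancel₀ hlam.ne' h2

/-- Nonnegativity of the second variation in the directions in which the positivity of `φ` (if
`a > 0`) is kept. -/
theorem IsConstrainedMinimizer.quad_nonneg (hα : 1 / 2 < α) (hlam : 0 < lam)
    (hmin : IsConstrainedMinimizer α a lam φ) (h0 : ∀ x, 0 ≤ φ x)
    (hpos : 0 < a → ∀ᵐ x, 0 < φ x)
    (hw : RealSobolev (α / 2) w) (horth : ∫ x, φ x * w x = 0)
    (hcone : 0 < a → ∀ᶠ t in 𝓝[>] (0 : ℝ), ∀ᵐ x,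
      0 ≤ (lam - (∫ x, w x ^ 2) * t ^ 2) * φ x + 2 * lam * t * w x) :
    0 ≤ quad α (multiplier α a lam φ) φ w := by
  obtain ⟨R, hR, h⟩ := hmin.expansion hα hlam h0 hw horth
  rw [hmin.firstVar_eq_zero hα hlam h0 hpos hw horth] at h
  refine nonneg_of_expansion_two (A := 2 * lam ^ 3) (by positivity) hR ?_
  rcases le_or_gt a 0 with ha | ha
  · refine Eventually.of_forall fun t => ?_
    have := h t
    rw [max_eq_right ha] at this
    linarith
  · filter_upwards [hcone ha] with t ht
    have hP : ∫ x, max (-((lam - (∫ x, w x ^ 2) * t ^ 2) * φ x + 2 * lam * t * w x)) 0 = 0 := by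
      refine (integral_congr_ae ?_).trans (integral_zero Circ ℝ)
      filter_upwards [ht] with x hx
      exact max_eq_right (neg_nonpos.2 hx)
    have := h t
    rw [hP] at this
    linarith

/-! ### The kernel of `L₊` on the Fourier side. -/

/-- The equation `L₊ h = 0` in terms of Fourier coefficients. -/
def FourierKer (α ω : ℝ) (φ : Circ → ℝ) (h : Circ → ℂ) : Prop :=
  InSobolev α h ∧ ∀ k : ℤ, (((Real.pi * |(k : ℝ)|) ^ α : ℝ) : ℂ) * fourierCoeff h k
    + ω * fourierCoeff h k - 2 * fourierCoeff (fun x => φ x * h x) k = 0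

theorem InSobolev.half {f : Circ → ℂ} (hα : 0 < α) (hf : InSobolev α f) :
    InSobolev (α / 2) f := by
  refine ⟨hf.1, Summable.of_nonneg_of_le (fun k => by positivity) (fun k => ?_) hf.2⟩
  gcongr
  · nlinarith [sq_nonneg |(k : ℝ)|]
  · linarith

theorem InSobolev.integrable {s : ℝ} {f : Circ → ℂ} (hf : InSobolev s f) : Integrable f :=
  hf.1.integrable (by norm_num)

theorem memLp_two_real_mul (hα : 1 / 2 < α) (hφ : RealSobolev (α / 2) φ) {h : Circ → ℂ}
    (hh : InSobolev α h) : MemLp (fun x => (φ x : ℂ) * h x) 2 volume :=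
  memLp_two_mul_four (InSobolev.memLp_four hα hφ)
    (InSobolev.memLp_four hα (hh.half (by linarith)))

theorem fourierKer_of_mem (hα : 1 / 2 < α) (hφ : RealSobolev (α / 2) φ) {h : Circ → ℂ}
    (hh : h ∈ kerLinPlus α ω φ) : FourierKer α ω φ h := by
  obtain ⟨hs, he⟩ := hh
  refine ⟨hs, fun k => ?_⟩
  have hF : Integrable (fracLap α h : Circ → ℂ) :=
    (memLp_haarAddCircle_iff.1 (Lp.memLp (fracLap α h))).integrable (by norm_num)
  have hI := hs.integrable
  have hp : Integrable fun x => (φ x : ℂ) * h x :=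
    (memLp_two_real_mul hα hφ hs).integrable (by norm_num)
  have hFh : Integrable fun x => 1 * (fracLap α h : Circ → ℂ) x + (ω : ℂ) * h x :=
    (hF.const_mul _).add (hI.const_mul _)
  rw [← ae_haarAddCircle_eq] at he
  have h1 := congrFun (fourierCoeff_congr_ae he) k
  have h2 : linPlus α ω φ h = fun x => 1 * (1 * (fracLap α h : Circ → ℂ) x + (ω : ℂ) * h x)
      + (-2) * ((φ x : ℂ) * h x) := by
    funext x
    simp only [linPlus]
    ring
  rw [h2, fourierCoeff_add_mul hFh hp,
    fourierCoeff_add_mul hF hI, fourierCoeff_fracLap (by linarith) hs] at h1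
  have h3 : fourierCoeff (0 : Circ → ℂ) k = 0 := by simp [fourierCoeff]
  rw [h3] at h1
  rw [← h1]
  ring

theorem InSobolev.congr {s : ℝ} {f g : Circ → ℂ} (hf : InSobolev s f) (h : f =ᵐ[volume] g) :
    InSobolev s g := by
  refine ⟨hf.1.ae_eq h, ?_⟩
  rw [← ae_haarAddCircle_eq] at h
  rw [← fourierCoeff_congr_ae h]
  exact hf.2

theorem FourierKer.congr {f g : Circ → ℂ} (hf : FourierKer α ω φ f) (h : f =ᵐ[volume] g) :
    FourierKer α ω φ g := by
  refine ⟨hf.1.congr h, ?_⟩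
  rw [← ae_haarAddCircle_eq] at h
  have h1 : fourierCoeff (fun x => (φ x : ℂ) * f x) = fourierCoeff (fun x => (φ x : ℂ) * g x) :=
    fourierCoeff_congr_ae (by filter_upwards [h] with x hx; rw [hx])
  rw [← fourierCoeff_congr_ae h, ← h1]
  exact hf.2

theorem FourierKer.const_mul {f : Circ → ℂ} (hf : FourierKer α ω φ f) (c : ℂ) :
    FourierKer α ω φ (fun x => c * f x) := by
  refine ⟨by simpa using InSobolev.add_mul hf.1 hf.1 c 0, fun k => ?_⟩
  have h1 : (fun x => (φ x : ℂ) * (c * f x)) = fun x => c * ((φ x : ℂ) * f x) := by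
    funext x; ring
  rw [h1, fourierCoeff.const_mul, fourierCoeff.const_mul]
  linear_combination c * hf.2 k

theorem InSobolev.conj {s : ℝ} {f : Circ → ℂ} (hf : InSobolev s f) :
    InSobolev s (fun x => conj (f x)) := by
  refine ⟨hf.1.star, ?_⟩
  have h := (Equiv.neg ℤ).summable_iff.2 hf.2
  refine h.congr fun k => ?_
  rw [fourierCoeff_conj, RCLike.norm_conj]
  simp

/-- The symbol is real and even and `ω`, `φ` are real, so the equation is preserved by complex
conjugation. -/
theorem FourierKer.re (hα : 1 / 2 < α) (hφ : RealSobolev (α / 2) φ) {f : Circ → ℂ}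
    (hf : FourierKer α ω φ f) : FourierKer α ω φ (toC fun x => (f x).re) := by
  have h1 : (toC fun x => (f x).re) = fun x => (1 / 2 : ℂ) * f x + (1 / 2 : ℂ) * conj (f x) := by
    funext x
    rw [← mul_add, Complex.add_conj]
    simp [toC]
  have h2 : (fun x => (φ x : ℂ) * (1 / 2 * f x + 1 / 2 * conj (f x)))
      = fun x => (1 / 2 : ℂ) * ((φ x : ℂ) * f x) + (1 / 2 : ℂ) * conj ((φ x : ℂ) * f x) := by
    funext x
    rw [map_mul, Complex.conj_ofReal]
    ring
  have hp := memLp_two_real_mul hα hφ hf.1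
  have hpi : Integrable fun x => (φ x : ℂ) * f x := hp.integrable (by norm_num)
  have hpc : Integrable fun x => conj ((φ x : ℂ) * f x) := hp.star.integrable (by norm_num)
  rw [h1]
  refine ⟨hf.1.add_mul hf.1.conj _ _, fun k => ?_⟩
  rw [h2, fourierCoeff_add_mul hf.1.integrable hf.1.conj.integrable,
    fourierCoeff_add_mul hpi hpc,
    fourierCoeff_conj, fourierCoeff_conj]
  have e1 := hf.2 k
  have e2 := congrArg conj (hf.2 (-k))
  simp only [map_sub, map_add, map_mul, Complex.conj_ofReal, map_zero, Complex.conj_ofNat,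
    Int.cast_neg, abs_neg] at e2
  linear_combination (1 / 2 : ℂ) * e1 + (1 / 2 : ℂ) * e2

/-- Multiply the `k`-th equation by the conjugate coefficient of `w`, sum over `k` and use Parseval.
-/
theorem FourierKer.bil_eq_zero (hα : 1 / 2 < α) (hφ : RealSobolev (α / 2) φ)
    (hr : FourierKer α ω φ (toC r)) (hw : RealSobolev (α / 2) w) : bil α ω φ r w = 0 := by
  have hr' : RealSobolev (α / 2) r := hr.1.half (by linarith)
  have hp := memLp_two_real_mul hα hφ hr.1
  have e0 : (fun x => (φ x : ℂ) * toC r x) = toC fun x => φ x * r x := by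
    funext x; simp [toC]
  have hp' : MemLp (fun x => φ x * r x) 2 volume := by
    rw [← memLp_toC, ← e0]
    exact hp
  have h1 := (summable_kin (by linarith) hr' hw).hasSum
  have h2 := hasSum_ft_mul_conj hr'.memLp_two hw.memLp_two
  have h3 := hasSum_ft_mul_conj hp' hw.memLp_two
  have h4 := (h1.add (h2.mul_left ω)).sub (h3.mul_left 2)
  have h5 : ∀ k : ℤ, (Real.pi * |(k : ℝ)|) ^ α * (ft r k * conj (ft w k)).re
      + ω * (ft r k * conj (ft w k)).re
      - 2 * (ft (fun x => φ x * r x) k * conj (ft w k)).re = 0 := by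
    intro k
    have h6 := hr.2 k
    rw [e0] at h6
    have h7 := congrArg (fun z => (z * conj (ft w k)).re) h6
    simp only [zero_mul, Complex.zero_re] at h7
    rw [← h7, ← ft, ← ft]
    have e : ∀ (x : ℝ) (z : ℂ), x * z.re = ((x : ℂ) * z).re := fun x z => by simp
    rw [e, e, e, ← Complex.add_re, ← Complex.sub_re]
    congr 1
    push_cast
    ring
  simp only [h5] at h4
  have h6 := h4.unique hasSum_zero
  rw [bil, kin]
  have e1 : ∫ x, φ x * (r x * w x) = ∫ x, φ x * r x * w x := by
    congr 1
    funext x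
    ring
  rw [e1]
  linarith

theorem bil_comm (u v : Circ → ℝ) : bil α ω φ u v = bil α ω φ v u := by
  rw [bil, bil, kin_comm]
  simp only [mul_comm (u _)]

/-! ### The case `a ≤ 0`. -/

theorem eq_zero_of_forall_nonneg {b q : ℝ} (h : ∀ ε : ℝ, 0 ≤ 2 * ε * b + ε ^ 2 * q) : b = 0 := by
  by_contra hb
  set s := |q| + 1
  have hs : 0 < s := by positivity
  have hq : q < s := (le_abs_self q).trans_lt (lt_add_one _)
  have h1 := h (-(b / s))
  have h2 : b = b / s * s := (div_mul_cancel₀ _ hs.ne').symm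
  have hy : 0 < (b / s) ^ 2 := by positivity
  set y := b / s
  rw [h2] at h1
  nlinarith

theorem FourierKer.quad_nonneg (hα : 1 / 2 < α) (ha : a ≤ 0) (hlam : 0 < lam)
    (hmin : IsConstrainedMinimizer α a lam φ) (h0 : ∀ x, 0 ≤ φ x)
    (hr : FourierKer α (multiplier α a lam φ) φ (toC r)) (hne : ∫ x, φ x * r x ≠ 0)
    (hw : RealSobolev (α / 2) w) : 0 ≤ quad α (multiplier α a lam φ) φ w := by
  have hφ : RealSobolev (α / 2) φ := hmin.sobolev
  have hr' : RealSobolev (α / 2) r := hr.1.half (by linarith)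
  -- The multiple of `r` that makes `w` orthogonal to `φ` is invisible to the form.
  have h1 := hmin.quad_nonneg hα hlam h0 (fun h => absurd ha (not_le.2 h))
    (hw.add_mul hr' 1 (-((∫ x, φ x * w x) / ∫ x, φ x * r x))) (by
      rw [integral_mul_add_mul hφ.memLp_two hw.memLp_two hr'.memLp_two]
      field_simp
      ring) (fun h => absurd ha (not_le.2 h))
  rw [quad_add_mul hα hφ hw hr', bil_comm, hr.bil_eq_zero hα hφ hw, ← bil_self (u := r),
    hr.bil_eq_zero hα hφ hr'] at h1
  linarith

/-- The reflection `x ↦ -x - t` exchanges `φ` and its translate, by evenness. -/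
theorem integral_sq_mul_translate (heven : ∀ x, φ (-x) = φ x) (t : Circ) :
    ∫ x, φ x ^ 2 * φ (x + t) = ∫ x, φ x * φ (x + t) ^ 2 := by
  rw [← integral_neg_eq_self, ← integral_add_right_eq_self _ t]
  congr 1
  funext x
  have h : -(x + t) + t = -x := by abel
  rw [h, heven, heven]
  ring

/-- If `L₊ ≥ 0` then the minimizer is invariant under translations. -/
theorem IsConstrainedMinimizer.translate_ae_eq (hα : 1 / 2 < α) (hlam : 0 < lam)
    (hmin : IsConstrainedMinimizer α a lam φ) (h0 : ∀ x, 0 ≤ φ x)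
    (heven : ∀ x, φ (-x) = φ x) (hpos : 0 < a → ∀ᵐ x, 0 < φ x)
    (hq : ∀ w, RealSobolev (α / 2) w → 0 ≤ quad α (multiplier α a lam φ) φ w) (t : Circ) :
    (fun x => φ (x + t)) =ᵐ[volume] φ := by
  have hα0 : 0 < α := by linarith
  have hφ : RealSobolev (α / 2) φ := hmin.sobolev
  have hφt := hφ.translate t
  have hom := multiplier_mul (a := a) hα0 hφ hlam
  have hel := hmin.euler_lagrange hα hlam h0 hpos hφt
  have hmean : ∫ x, φ (x + t) = ∫ x, φ x := integral_add_right_eq_self φ t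
  have hmass : ∫ x, φ (x + t) ^ 2 = lam := by
    rw [integral_add_right_eq_self (fun x => φ x ^ 2) t, hmin.mass]
  rw [hmean] at hel
  have hsym := integral_sq_mul_translate heven t
  have hψ := hφt.add_mul hφ 1 (-1)
  have e1 : ∫ x, φ (x + t) * φ x = ∫ x, φ x * φ (x + t) := by
    congr 1
    funext x
    ring
  have e2 : ∫ x, φ x * (φ (x + t) * φ x) = ∫ x, φ x ^ 2 * φ (x + t) := by
    congr 1
    funext x
    ring
  have e3 : ∫ x, φ x * φ x ^ 2 = ∫ x, φ x ^ 3 := by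
    congr 1
    funext x
    ring
  have hzero : quad α (multiplier α a lam φ) φ (fun x => 1 * φ (x + t) + -1 * φ x) = 0 := by
    rw [quad_add_mul hα hφ hφt hφ, quad, quad, bil, kin_translate, kin_comm (fun x => φ (x + t)) φ, hmass, hmin.mass,
      e1, e2, e3, hel]
    linear_combination 2 * hom + 2 * hsym
  have hone : RealSobolev (α / 2) fun _ => 1 := realSobolev_one
  -- A nonnegative form that vanishes at `ψ` has `ψ` in its kernel; testing with `1` removes the
  -- kinetic part.
  have hb : bil α (multiplier α a lam φ) φ (fun x => 1 * φ (x + t) + -1 * φ x) (fun _ => 1) = 0 := by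
    refine eq_zero_of_forall_nonneg
      (q := quad α (multiplier α a lam φ) φ fun _ => 1) fun ε => ?_
    have := hq _ (hψ.add_mul hone 1 ε)
    rw [quad_add_mul hα hφ hψ hone, hzero] at this
    linarith
  simp only [bil, mul_one, kin_one_right hα0] at hb
  rw [integral_add_mul hφt.integrable hφ.integrable,
    integral_mul_add_mul hφ.memLp_two hφt.memLp_two hφ.memLp_two, hmean] at hb
  have e4 : ∫ x, φ x * φ x = lam := by simpa only [pow_two] using hmin.mass
  rw [e4] at hb
  have hsq : ∫ x, (1 * φ (x + t) + -1 * φ x) ^ 2 = 0 := by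
    rw [integral_add_mul_sq hφt.memLp_two hφ.memLp_two, hmass, hmin.mass, e1]
    linarith
  rw [integral_eq_zero_iff_of_nonneg (fun x => by positivity) hψ.memLp_two.integrable_sq] at hsq
  filter_upwards [hsq] with x hx
  have : (1 * φ (x + t) + -1 * φ x) ^ 2 = 0 := hx
  have := pow_eq_zero_iff (two_ne_zero) |>.1 this
  linarith

/-- Translation by half a period of the `k`-th mode changes the sign of its coefficient, so all
coefficients with `k ≠ 0` vanish. -/
theorem ae_const_of_translate_ae_eq (hu : MemLp u 2 volume)
    (h : ∀ t : Circ, (fun x => u (x + t)) =ᵐ[volume] u) :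
    ∀ᵐ x, u x = (1 / 2) * ∫ x, u x := by
  have hk : ∀ k : ℤ, k ≠ 0 → ft u k = 0 := by
    intro k hk
    set t : Circ := ((2 / 2 / (k : ℝ) : ℝ) : Circ) with ht
    have h1 : ft (fun x => u (x + t)) k = ft u k := by
      have := h t
      rw [← ae_haarAddCircle_eq] at this
      refine congrFun (fourierCoeff_congr_ae ?_) k
      filter_upwards [this] with x hx
      simp only [toC]
      rw [hx]
    rw [ft_translate] at h1
    have h2 := fourier_add_half_inv_index hk (two_pos : (0 : ℝ) < 2) 0
    rw [zero_add, fourier_eval_zero] at h2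
    rw [ht, h2] at h1
    linear_combination (-1 / 2 : ℂ) * h1
  set c := (1 / 2) * ∫ x, u x with hc
  have hone : MemLp (fun _ : Circ => (1 : ℝ)) 2 volume := memLp_const 1
  have hm : MemLp (fun x => 1 * u x + (-c) * 1) 2 volume :=
    (hu.const_mul 1).add (hone.const_mul (-c))
  have hs := hasSum_ft_mul_conj hm hm
  have hz : ∀ k, ft (fun x => 1 * u x + (-c) * 1) k = 0 := by
    intro k
    rw [ft_add_mul (hu.integrable (by norm_num)) (hone.integrable (by norm_num)), ft_one]
    by_cases h0 : k = 0
    · subst h0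
      rw [ft_zero_eq, ← hc]
      simp
    · simp [hk k h0, h0]
  simp only [hz, zero_mul, Complex.zero_re] at hs
  have hi := hs.unique hasSum_zero
  have hi2 : ∫ x, (1 * u x + (-c) * 1) ^ 2 = 0 := by
    simp only [pow_two]
    linarith
  rw [integral_eq_zero_iff_of_nonneg (fun x => by positivity) hm.integrable_sq] at hi2
  filter_upwards [hi2] with x hx
  have : (1 * u x + (-c) * 1) ^ 2 = 0 := hx
  have := pow_eq_zero_iff (two_ne_zero) |>.1 this
  linarith

theorem FourierKer.orthogonal_of_nonpos (hα : 1 / 2 < α) (ha : a ≤ 0) (hlam : 0 < lam)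
    (hmin : IsConstrainedMinimizer α a lam φ) (hbell : IsBellShaped φ)
    (hconst : a = -lam / 2 → ¬ ∃ c : ℝ, ∀ᵐ x, φ x = c)
    (hr : FourierKer α (multiplier α a lam φ) φ (toC r)) : ∫ x, φ x * r x = 0 := by
  by_contra hne
  have hφ : RealSobolev (α / 2) φ := hmin.sobolev
  have hpos : 0 < a → ∀ᵐ x, 0 < φ x := fun h => absurd ha (not_le.2 h)
  have hq : ∀ w, RealSobolev (α / 2) w → 0 ≤ quad α (multiplier α a lam φ) φ w :=
    fun w hw => hr.quad_nonneg hα ha hlam hmin hbell.nonneg hne hw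
  have hc := ae_const_of_translate_ae_eq hφ.memLp_two
    (hmin.translate_ae_eq hα hlam hbell.nonneg hbell.even hpos hq)
  set c := (1 / 2) * ∫ x, φ x with hcdef
  refine hconst ?_ ⟨c, hc⟩
  have hvol : (volume : Measure Circ).real Set.univ = 2 := by
    rw [measureReal_def, AddCircle.measure_univ, ENNReal.toReal_ofReal two_pos.le]
  have hlam2 : lam = 2 * c ^ 2 := by
    rw [← hmin.mass, integral_congr_ae (g := fun _ => c ^ 2) (by
      filter_upwards [hc] with x hx
      rw [hx]), integral_const, hvol, smul_eq_mul]
  have hone : RealSobolev (α / 2) fun _ => 1 := realSobolev_one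
  have hel := hmin.euler_lagrange hα hlam hbell.nonneg hpos hone
  simp only [kin_one_right (by linarith : 0 < α), mul_one, hmin.mass, integral_const, hvol,
    smul_eq_mul] at hel
  have hb := hr.bil_eq_zero hα hφ hone
  simp only [bil, kin_one_right (by linarith : 0 < α), mul_one] at hb
  have hφr : ∫ x, φ x * r x = c * ∫ x, r x := by
    rw [← integral_const_mul]
    refine integral_congr_ae ?_
    filter_upwards [hc] with x hx
    rw [hx]
  rw [hφr] at hb hne
  -- With `φ = c`, pairing `r` with `1` gives `ω = 2 c`. The Euler–Lagrange equation tested with `1`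
  -- then reads `0 = 2 c² - 2 a - 4 c²`, that is, `a = -lam / 2`.
  have h1 : (multiplier α a lam φ - 2 * c) * ∫ x, r x = 0 := by linarith
  have h2 : multiplier α a lam φ = 2 * c := by
    rcases mul_eq_zero.1 h1 with h | h
    · linarith
    · rw [h, mul_zero] at hne
      exact absurd rfl hne
  have h3 : ∫ x, φ x = 2 * c := by linarith
  rw [h2, h3] at hel
  nlinarith

/-! ### The case `a > 0`. -/

/-- Off a small interval around `1`, monotonicity bounds `φ` below by `φ (1 - e)`, which is positive
because `φ` is positive at some point of `(1 - e, 1)`. -/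
theorem IsBellShaped.exists_le_of_notMem (hbell : IsBellShaped φ) (hpos : ∀ᵐ x, 0 < φ x)
    {U : Set Circ} (hU : U ∈ 𝓝 ((1 : ℝ) : Circ)) : ∃ δ > 0, ∀ x ∉ U, δ ≤ φ x := by
  have hU' : (fun y : ℝ => (y : Circ)) ⁻¹' U ∈ 𝓝 (1 : ℝ) :=
    (AddCircle.continuous_mk' 2).continuousAt.preimage_mem_nhds hU
  obtain ⟨ε, hε, hball⟩ := Metric.mem_nhds_iff.1 hU'
  set e := min ε (1 / 2) with he
  have he0 : 0 < e := lt_min hε (by norm_num)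
  have he1 : e ≤ 1 / 2 := min_le_right _ _
  have hin : ∀ y : ℝ, |y - 1| < e → (y : Circ) ∈ U := fun y hy =>
    hball (by rw [Metric.mem_ball, Real.dist_eq]; exact hy.trans_le (min_le_left _ _))
  refine ⟨φ ((1 - e : ℝ) : Circ), ?_, fun x hx => ?_⟩
  · have hopen : IsOpen ((fun y : ℝ => (y : Circ)) '' Set.Ioo (1 - e) 1) :=
      QuotientAddGroup.isOpenMap_coe _ isOpen_Ioo
    obtain ⟨_, ⟨y, hy, rfl⟩, hyp⟩ := (Measure.dense_of_ae hpos).inter_open_nonempty _ hopen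
      ((Set.nonempty_Ioo.2 (by linarith)).image _)
    have hyp : 0 < φ (y : Circ) := hyp
    exact hyp.trans_le (hbell.anti ⟨by linarith, by linarith⟩
      ⟨by linarith [hy.1], hy.2.le⟩ hy.1.le)
  · have hx' : ∃ y ∈ Set.Ioc (-1 : ℝ) (-1 + 2), (y : Circ) = x :=
      ⟨_, (AddCircle.equivIoc 2 (-1) x).2, (AddCircle.equivIoc 2 (-1)).symm_apply_apply x⟩
    obtain ⟨y, ⟨hy1, hy2⟩, rfl⟩ := hx'
    have habs : φ (y : Circ) = φ ((|y| : ℝ) : Circ) := by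
      rcases abs_choice y with h | h
      · rw [h]
      · rw [h, AddCircle.coe_neg, hbell.even]
    have hle : |y| ≤ 1 - e := by
      by_contra! hlt
      refine hx ?_
      rcases le_total 0 y with h | h
      · rw [abs_of_nonneg h] at hlt
        exact hin y (by rw [abs_lt]; constructor <;> linarith)
      · rw [abs_of_nonpos h] at hlt
        have := hin (y + 2) (by rw [abs_lt]; constructor <;> linarith)
        rwa [AddCircle.coe_add_period] at this
    rw [habs]
    exact hbell.anti ⟨abs_nonneg y, by linarith⟩ ⟨by linarith, by linarith⟩ hle

/-- Provides the admissible directions. Where `κ > 0`, in particular near `1`, both parts are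
nonnegative; elsewhere `φ ≥ δ` dominates the bounded `κ` for small `t`. -/
theorem IsBellShaped.eventually_nonneg (hbell : IsBellShaped φ) (hpos : ∀ᵐ x, 0 < φ x)
    (hlam : 0 < lam) {κ : Circ → ℝ} (hκ : Continuous κ) (hκ1 : 0 < κ ((1 : ℝ) : Circ))
    (G σ : ℝ) : ∀ᶠ t in 𝓝[>] (0 : ℝ), ∀ x,
      0 ≤ (lam - G * t ^ 2) * φ x + 2 * lam * t * (σ * φ x + κ x) := by
  obtain ⟨δ, hδ, hφδ⟩ := hbell.exists_le_of_notMem hpos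
    (hκ.continuousAt.eventually (lt_mem_nhds hκ1))
  obtain ⟨K, hK⟩ := isCompact_univ.exists_bound_of_continuousOn hκ.continuousOn
  have h1 : ∀ᶠ t in 𝓝[>] (0 : ℝ), lam / 2 < lam - G * t ^ 2 + 2 * lam * t * σ := by
    have : Tendsto (fun t : ℝ => lam - G * t ^ 2 + 2 * lam * t * σ) (𝓝[>] 0)
        (𝓝 (lam - G * 0 ^ 2 + 2 * lam * 0 * σ)) :=
      (Continuous.tendsto (by fun_prop) 0).mono_left nhdsWithin_le_nhds
    refine this.eventually_const_lt ?_
    simp only [ne_eq, OfNat.ofNat_ne_zero, not_false_eq_true, zero_pow, mul_zero, zero_mul]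
    linarith
  have h2 : ∀ᶠ t in 𝓝[>] (0 : ℝ), 2 * lam * t * K < lam / 2 * δ := by
    have : Tendsto (fun t : ℝ => 2 * lam * t * K) (𝓝[>] 0) (𝓝 (2 * lam * 0 * K)) :=
      (Continuous.tendsto (by fun_prop) 0).mono_left nhdsWithin_le_nhds
    refine this.eventually_lt_const ?_
    rw [mul_zero, zero_mul]
    positivity
  filter_upwards [h1, h2, self_mem_nhdsWithin] with t ht1 ht2 ht0 x
  have ht0 : 0 < t := ht0
  have e : (lam - G * t ^ 2) * φ x + 2 * lam * t * (σ * φ x + κ x)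
      = (lam - G * t ^ 2 + 2 * lam * t * σ) * φ x + 2 * lam * t * κ x := by ring
  rw [e]
  have h3 : lam / 2 * φ x ≤ (lam - G * t ^ 2 + 2 * lam * t * σ) * φ x :=
    mul_le_mul_of_nonneg_right ht1.le (hbell.nonneg x)
  by_cases hx : 0 < κ x
  · have h4 : 0 ≤ lam / 2 * φ x := mul_nonneg (by linarith) (hbell.nonneg x)
    have h5 : 0 ≤ 2 * lam * t * κ x := by positivity
    linarith
  · have h4 : lam / 2 * δ ≤ lam / 2 * φ x :=
      mul_le_mul_of_nonneg_left (hφδ x hx) (by linarith)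
    have h5 : -K ≤ κ x := (abs_le.1 (hK x (Set.mem_univ x))).1
    have h6 : 2 * lam * t * (-K) ≤ 2 * lam * t * κ x :=
      mul_le_mul_of_nonneg_left h5 (by positivity)
    linarith

theorem FourierKer.orthogonal_of_pos (hα : 1 / 2 < α) (ha : 0 < a) (hlam : 0 < lam)
    (hmin : IsConstrainedMinimizer α a lam φ) (hbell : IsBellShaped φ)
    (hpos : ∀ᵐ x, 0 < φ x) (hcont : Continuous r)
    (hr : FourierKer α (multiplier α a lam φ) φ (toC r)) : ∫ x, φ x * r x = 0 := by
  by_contra hne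
  have hα0 : 0 < α := by linarith
  have hφ : RealSobolev (α / 2) φ := hmin.sobolev
  have hr' : RealSobolev (α / 2) r := hr.1.half hα0
  have hone : RealSobolev (α / 2) fun _ => 1 := realSobolev_one
  have hom := multiplier_mul (a := a) hα0 hφ hlam
  set ω := multiplier α a lam φ with hω
  set I := ∫ x, φ x * r x with hI
  set m := ∫ x, φ x with hm
  have hm0 : 0 < m := by
    refine lt_of_le_of_ne (integral_nonneg hbell.nonneg) fun h => ?_
    have h1 := (integral_eq_zero_iff_of_nonneg hbell.nonneg hφ.integrable).1 h.symm
    have h2 : ∫ x, φ x ^ 2 = 0 := by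
      refine (integral_congr_ae ?_).trans (integral_zero Circ ℝ)
      filter_upwards [h1] with x hx
      rw [hx]
      simp
    rw [hmin.mass] at h2
    exact hlam.ne' h2
  -- The definition of the multiplier gives the value `-∫ φ³ - a ∫ φ`.
  have hqφ : quad α ω φ φ < 0 := by
    have h3 : ∫ x, φ x * φ x ^ 2 = ∫ x, φ x ^ 3 := by
      congr 1
      funext x
      ring
    have h4 : 0 ≤ ∫ x, φ x ^ 3 := integral_nonneg fun x => pow_nonneg (hbell.nonneg x) 3
    rw [quad, hmin.mass, h3]
    nlinarith [mul_pos ha hm0]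
  set b1 := bil α ω φ φ (fun _ => 1) with hb1
  set q1 := quad α ω φ (fun _ => 1) with hq1
  -- The first and third conditions hold for all small `τ`, and the second excludes at most one
  -- value. The third is the value of the form at `w` below, where `r` does not contribute.
  obtain ⟨τ, hτI, hτ1, hτq⟩ : ∃ τ : ℝ, I + τ * m ≠ 0 ∧ r ((1 : ℝ) : Circ) + τ ≠ 0 ∧
      quad α ω φ φ - 2 * (lam / (I + τ * m) * τ) * b1 + (lam / (I + τ * m) * τ) ^ 2 * q1 < 0 := by
    have hl : Tendsto (fun τ : ℝ => I + τ * m) (𝓝 0) (𝓝 I) := by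
      have : Tendsto (fun τ : ℝ => I + τ * m) (𝓝 0) (𝓝 (I + 0 * m)) :=
        Continuous.tendsto (by fun_prop) 0
      simpa using this
    have h1 : Tendsto (fun τ : ℝ => lam / (I + τ * m) * τ) (𝓝 0) (𝓝 (lam / I * 0)) :=
      (tendsto_const_nhds.div hl hne).mul tendsto_id
    rw [mul_zero] at h1
    have h2 : Tendsto (fun τ : ℝ => quad α ω φ φ - 2 * (lam / (I + τ * m) * τ) * b1
        + (lam / (I + τ * m) * τ) ^ 2 * q1) (𝓝 0)
        (𝓝 (quad α ω φ φ - 2 * 0 * b1 + 0 ^ 2 * q1)) :=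
      ((tendsto_const_nhds.sub ((h1.const_mul 2).mul_const b1)).add ((h1.pow 2).mul_const q1))
    have h3 := h2.eventually_lt_const (u := 0) (by simpa using hqφ)
    have h4 := hl.eventually_ne hne
    have h5 : ∀ᶠ τ in 𝓝[≠] (0 : ℝ), r ((1 : ℝ) : Circ) + τ ≠ 0 := by
      by_cases h : r ((1 : ℝ) : Circ) = 0
      · filter_upwards [self_mem_nhdsWithin] with τ hτ
        rw [h, zero_add]
        exact hτ
      · have : Tendsto (fun τ : ℝ => r ((1 : ℝ) : Circ) + τ) (𝓝 0) (𝓝 (r ((1 : ℝ) : Circ) + 0)) :=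
          Continuous.tendsto (by fun_prop) 0
        rw [add_zero] at this
        exact (this.eventually_ne h).filter_mono nhdsWithin_le_nhds
    obtain ⟨τ, ⟨h6, h7⟩, h8⟩ :=
      (((h4.and h3).filter_mono nhdsWithin_le_nhds).and h5).exists
    exact ⟨τ, h6, h8, h7⟩
  set c := lam / (I + τ * m) with hc
  have hc0 : c ≠ 0 := div_ne_zero hlam.ne' hτI
  have hcI : c * (I + τ * m) = lam := div_mul_cancel₀ _ hτI
  have hη := hφ.add_mul hone 1 (-(c * τ))
  have hw := hη.add_mul hr' 1 (-c)
  set w : Circ → ℝ := fun x => 1 * (1 * φ x + -(c * τ) * 1) + -c * r x with hwdef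
  have hqw : quad α ω φ w < 0 := by
    rw [hwdef, quad_add_mul hα hφ hη hr', quad_add_mul hα hφ hφ hone, bil_comm _ r,
      hr.bil_eq_zero hα hφ hη, ← bil_self (u := r), hr.bil_eq_zero hα hφ hr', ← hb1, ← hq1]
    linarith
  have horth : ∫ x, φ x * w x = 0 := by
    have e4 : ∫ x, φ x * φ x = lam := by simpa only [pow_two] using hmin.mass
    rw [hwdef, integral_mul_add_mul hφ.memLp_two hη.memLp_two hr'.memLp_two,
      integral_mul_add_mul hφ.memLp_two hφ.memLp_two hone.memLp_two, e4]
    simp only [mul_one]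
    rw [← hI, ← hm]
    linarith
  have hκ0 : -c * (r ((1 : ℝ) : Circ) + τ) ≠ 0 := mul_ne_zero (neg_ne_zero.2 hc0) hτ1
  -- The form is even, so the sign of `w` may be chosen to make the perturbation upward at `1`.
  obtain ⟨σ, hσ, hσκ⟩ : ∃ σ : ℝ, σ ^ 2 = 1 ∧ 0 < σ * (-c * (r ((1 : ℝ) : Circ) + τ)) := by
    rcases lt_or_gt_of_ne hκ0 with h | h
    · exact ⟨-1, by norm_num, by linarith⟩
    · exact ⟨1, by norm_num, by linarith⟩
  have hsw := hw.add_mul hw σ 0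
  have hcone := hbell.eventually_nonneg hpos hlam
    (κ := fun x => σ * (-c * (r x + τ))) (by fun_prop) hσκ (∫ x, (σ * w x + 0 * w x) ^ 2) σ
  have hq := hmin.quad_nonneg hα hlam hbell.nonneg (fun _ => hpos) hsw (by
    rw [integral_mul_add_mul hφ.memLp_two hw.memLp_two hw.memLp_two, horth]
    ring) (fun _ => by
    filter_upwards [hcone] with t ht
    refine ae_of_all _ fun x => ?_
    convert ht x using 3
    rw [hwdef]
    ring)
  rw [quad_add_mul hα hφ hw hw, hσ, ← hω] at hq
  linarith

end FracWave

end

/-! ### Reduction to real, continuous kernel elements. -/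

theorem lemma9 (α a lam : ℝ) (hα : 1 / 2 < α) (hα' : α ≤ 2) (hlam : 0 < lam)
    (φ : FracWave.Circ → ℝ)
    (hmin : FracWave.IsConstrainedMinimizer α a lam φ)
    (hbell : FracWave.IsBellShaped φ)
    (hpos : 0 < a → ∀ᵐ x, 0 < φ x)
    (hconst : a = -lam / 2 → ¬ ∃ c : ℝ, ∀ᵐ x, φ x = c) :
    ∀ h ∈ FracWave.kerLinPlus α (FracWave.multiplier α a lam φ) φ,
      ∫ x, h x * (φ x : ℂ) = 0 := by
  intro h hh
  have hφ : FracWave.RealSobolev (α / 2) φ := hmin.sobolev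
  have hk := FracWave.fourierKer_of_mem hα hφ hh
  obtain ⟨g, hg⟩ := hk.1.exists_continuous hα
  have hkg := hk.congr hg
  have hreal : ∀ f : FracWave.Circ → ℂ, Continuous f →
      FracWave.FourierKer α (FracWave.multiplier α a lam φ) φ f →
      ∫ x, φ x * (f x).re = 0 := by
    intro f hf hkf
    rcases le_or_gt a 0 with ha | ha
    · exact (hkf.re hα hφ).orthogonal_of_nonpos hα ha hlam hmin hbell hconst
    · exact (hkf.re hα hφ).orthogonal_of_pos hα ha hlam hmin hbell (hpos ha)
        (Complex.continuous_re.comp hf)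
  have h1 := hreal g g.continuous hkg
  -- The real part of `-i g` is the imaginary part of `g`.
  have h2 := hreal (fun x => -Complex.I * g x) (by fun_prop) (hkg.const_mul _)
  have hint : Integrable fun x => (φ x : ℂ) * g x :=
    (FracWave.memLp_two_real_mul hα hφ hkg.1).integrable (by norm_num)
  have e : ∫ x, h x * (φ x : ℂ) = ∫ x, (φ x : ℂ) * g x := by
    refine integral_congr_ae ?_
    filter_upwards [hg] with x hx
    rw [hx, mul_comm]
  rw [e, ← integral_re_add_im hint]
  have h3 : ∫ x, RCLike.re ((φ x : ℂ) * g x) = 0 := by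
    rw [← h1]
    congr 1
    funext x
    simp
  have h4 : ∫ x, RCLike.im ((φ x : ℂ) * g x) = 0 := by
    rw [← h2]
    congr 1
    funext x
    simp
  rw [h3, h4]
  simp
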